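/- A virtual double category $\mathbb{D}$ consists of a category $\mathbb{D}_0$ of objects and vertical arrows, proarrows $A\colon c\nrightarrow d$ between objects, and 2-cells $\phi\in{}_f\mathbb{D}_g(A_1,\dots,A_n;B)$ ($n\ge 0$) whose source is a composable string of proarrows $A_1,\dots,A_n$ from $c_0$ to $c_n$, whose target is a proarrow $B\colon d_0\nrightarrow d_1$, and whose frames are vertical arrows $f\colon c_0\to d_0$, $g\colon c_n\to d_1$, with identity 2-cells and an associative and unital multi-composition. A cell $\kappa\in{}_f\mathbb{D}_g(P;Q)$ is cartesian if composing with it gives bijections ${}_h\mathbb{D}_k(R_1,\dots,R_n;P)\cong{}_{fh}\mathbb{D}_{gk}(R_1,\dots,R_n;Q)$; a cell $(P_1,\dots,P_n)\to Q$ with identity frames is opcartesian if composing with it gives bijections ${}_f\mathbb{D}_g(\vec R,Q,\vec S;T)\cong{}_f\mathbb{D}_g(\vec R,\vec P,\vec S;T)$. A unit of $c$ is a proarrow $U_c\colon c\nrightarrow c$ with an opcartesian cell from the empty string at $c$. $\mathbb{D}$ is a virtual equipment if every object has a unit and for all $f,g,Q$ there is a cartesian cell over $f,g$ with target $Q$.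 $\mathrm{Mod}(\mathbb{D})$ is the virtual double category whose objects are the monoids $(c,M)$ in $\mathbb{D}$ (a proarrow $M\colon c\nrightarrow c$ with a unit cell and a multiplication cell, associative and unital), whose vertical arrows are the monoid homomorphisms $(f,\vec f)$ ($f\colon c\to d$ a vertical arrow and $\vec f\in{}_f\mathbb{D}_f(M;N)$ a cell that respects units and multiplications), whose proarrows are the bimodules, and whose 2-cells are the bimodule homomorphisms, i.e. the cells of $\mathbb{D}$ compatible with all actions. In a virtual equipment, every object $x$ carries a trivial monoid on $U_x$, and every proarrow is a bimodule between trivial monoids. An embedding of a monoid $M$ into $x$ is a homomorphism from $M$ to the trivial monoid on $x$; a collapse of $M$ is a universal embedding $i\colon M\to x$ (every embedding of $M$ factors through $i$ by a unique vertical arrow out of $x$). An embedding of an $(M,N)$-bimodule $B$ into a proarrow $P\colon x\nrightarrow y$, over embeddings of $M$ and $N$, is a bimodule homomorphism from $B$ to $P$; it is a bimodule collapse if it lies over collapses $i\colon M\to x$, $j\colon N\to y$ and, for all $h\colon x\to x'$, $k\colon y\to y'$ and $Q\colon x'\nrightarrow y'$, composing with it is a bijection from ${}_h\mathbb{D}_k(P;Q)$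 to the embeddings of $B$ into $Q$ over $hi$ and $kj$. A collapse $(i,\vec\imath)\colon M\to x$ is normal if $\vec\imath\colon M\to U_x$ is also a bimodule collapse of $M$ regarded as an $(M,M)$-bimodule. The kernel of $f\colon c\to d$ is the restriction of $U_d$ along $f$ on both sides, with the unique monoid structure that makes its cartesian cell an embedding into $d$; $f$ is a regular cover if this embedding is a normal collapse. A monoid is effective if it is a kernel. A virtual equipment is regular if (1) every effective monoid has a normal collapse, and (2) for all regular covers $f\colon c\to d$, $g\colon c'\to d'$ and every proarrow $B\colon d\nrightarrow d'$, every cartesian embedding of a $(\ker f,\ker g)$-bimodule into $B$ over the kernel embeddings of $f$ and $g$ is a bimodule collapse. **Proposition.** Let $\mathbb{D}$ be a virtual equipment. Then $\mathrm{Mod}(\mathbb{D})$ is a regular virtual equipment. Moreover: (a) every monoid in $\mathrm{Mod}(\mathbb{D})$ has a normal collapse; (b) a vertical arrow $(f,\vec f)$ of $\mathrm{Mod}(\mathbb{D})$ is a regular cover if and only if $f$ is an isomorphism in $\mathbb{D}_0$; (c) if $F\colon X\to Y$ and $G\colon X'\to Y'$ are regular covers in $\mathrm{Mod}(\mathbb{D})$,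 then a 2-cell $\phi\colon A\to B$ with one-term source and with frames $F$ and $G$ is cartesian if and only if its underlying 2-cell in $\mathbb{D}$ is an isomorphism; and an embedding of a $(\ker F,\ker G)$-bimodule into a proarrow $Y\nrightarrow Y'$, over the kernel embeddings of $F$ and $G$, is a bimodule collapse if and only if it is cartesian. -/

import Mathlib

open CategoryTheory

universe w z v u

namespace VDC

/-- Composable strings `A₁, …, Aₙ` (`n ≥ 0`) of proarrows. -/
inductive HPath {C : Type u} (Pro : C → C → Type w) : C → C → Type (max u w)
  | nil (a : C) : HPath Pro a a
  | cons {a b c : C} (A : Pro a b) (P : HPath Pro b c) : HPath Pro a c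

/-- Concatenation of composable strings. -/
def HPath.append {C : Type u} {Pro : C → C → Type w} :
    {a b c : C} → HPath Pro a b → HPath Pro b c → HPath Pro a c
  | _, _, _, .nil _, Q => Q
  | _, _, _, .cons A P, Q => .cons A (P.append Q)

/-- The string of length one. -/
abbrev HPath.one {C : Type u} {Pro : C → C → Type w} {a b : C} (A : Pro a b) : HPath Pro a b :=
  .cons A (.nil b)

theorem HPath.append_nil {C : Type u} {Pro : C → C → Type w} {a b : C} (P : HPath Pro a b) :
    P.append (.nil b) = P := by
  induction P with
  | nil => rfl
  | cons A P ih => simp only [HPath.append, ih]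

theorem HPath.append_assoc {C : Type u} {Pro : C → C → Type w} {a b c d : C}
    (P : HPath Pro a b) (Q : HPath Pro b c) (R : HPath Pro c d) :
    (P.append Q).append R = P.append (Q.append R) := by
  induction P with
  | nil => rfl
  | cons A P ih => simp only [HPath.append, ih]

/-- Proarrows and 2-cells on a vertical category `C`; `Cell f g P B` is the set of 2-cells with
left frame `f`, right frame `g`, multi-source the string `P` and target `B`. -/
class VirtualDoubleGraph (C : Type u) [Category.{v} C] where
  Pro : C → C → Type w
  Cell : {a b a' b' : C} → (a ⟶ a') → (b ⟶ b') → HPath Pro a b → Pro a' b' → Type z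

open VirtualDoubleGraph

/-- Horizontally composable strings of 2-cells: adjacent cells share their frame.  The
source of such a string is the concatenation of the sources of the cells, and its target is the
string of their targets.  The concatenation is recorded by an equation. -/
inductive CellPath {C : Type u} [Category.{v} C] [VirtualDoubleGraph.{w, z} C] :
    {a b a' b' : C} → (a ⟶ a') → (b ⟶ b') → HPath (Pro (C := C)) a b →
      HPath (Pro (C := C)) a' b' → Type (max u v w z)
  | nil {a a' : C} (f : a ⟶ a') : CellPath f f (.nil a) (.nil a')
  | cons {a b c a' b' c' : C} {f : a ⟶ a'} {g : b ⟶ b'} {h : c ⟶ c'}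
      {R : HPath (Pro (C := C)) a b} {B : Pro a' b'} {P : HPath (Pro (C := C)) b c}
      {Q : HPath (Pro (C := C)) b' c'} {S : HPath (Pro (C := C)) a c}
      (φ : Cell f g R B) (φs : CellPath g h P Q) (hS : S = R.append P) :
      CellPath f h S (.cons B Q)

section Graph

variable {C : Type u} [Category.{v} C] [VirtualDoubleGraph.{w, z} C]

/-- The string consisting of one cell. -/
def CellPath.one {a b a' b' : C} {f : a ⟶ a'} {g : b ⟶ b'} {R : HPath (Pro (C := C)) a b}
    {B : Pro a' b'} (φ : Cell f g R B) : CellPath f g R (.one B) :=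
  .cons φ (.nil g) R.append_nil.symm

/-- The string consisting of two cells. -/
def CellPath.two {a b c a' b' c' : C} {f : a ⟶ a'} {g : b ⟶ b'} {h : c ⟶ c'}
    {R : HPath (Pro (C := C)) a b} {B : Pro a' b'} {S : HPath (Pro (C := C)) b c}
    {B' : Pro b' c'} {T : HPath (Pro (C := C)) a c} (φ : Cell f g R B) (ψ : Cell g h S B')
    (hT : T = R.append S) : CellPath f h T (.cons B (.one B')) :=
  .cons φ (.one ψ) hT

/-- Concatenation of strings of cells. -/
def CellPath.append {a b c a' b' c' : C} {f : a ⟶ a'} {g : b ⟶ b'} {h : c ⟶ c'}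
    {P : HPath (Pro (C := C)) a b} {Q : HPath (Pro (C := C)) a' b'}
    {P' : HPath (Pro (C := C)) b c} {Q' : HPath (Pro (C := C)) b' c'} :
    CellPath f g P Q → CellPath g h P' Q' → CellPath f h (P.append P') (Q.append Q')
  | .nil _, y => y
  | .cons φ x hS, y => .cons φ (x.append y) (by rw [hS, HPath.append_assoc])

/-- `IsAppend x y z`: the string `z` is the concatenation of `x` and `y` (as a relation, so that
the source and target of `z` need only be provably equal to the concatenations). -/
inductive IsAppend : {a b c a' b' c' : C} → {f : a ⟶ a'} → {g : b ⟶ b'} → {h : c ⟶ c'} →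
    {P : HPath (Pro (C := C)) a b} → {Q : HPath (Pro (C := C)) a' b'} →
    {P' : HPath (Pro (C := C)) b c} → {Q' : HPath (Pro (C := C)) b' c'} →
    {S : HPath (Pro (C := C)) a c} → {T : HPath (Pro (C := C)) a' c'} →
    CellPath f g P Q → CellPath g h P' Q' → CellPath f h S T → Prop
  | nil {a b a' b' : C} (f : a ⟶ a') {g : b ⟶ b'} {P : HPath (Pro (C := C)) a b}
      {Q : HPath (Pro (C := C)) a' b'} (y : CellPath f g P Q) : IsAppend (.nil f) y y
  | cons {a b c d a' b' c' d' : C} {f : a ⟶ a'} {g : b ⟶ b'} {h : c ⟶ c'} {k : d ⟶ d'}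
      {R : HPath (Pro (C := C)) a b} {B : Pro a' b'}
      {P : HPath (Pro (C := C)) b c} {Q : HPath (Pro (C := C)) b' c'}
      {P' : HPath (Pro (C := C)) c d} {Q' : HPath (Pro (C := C)) c' d'}
      {S : HPath (Pro (C := C)) b d} {T : HPath (Pro (C := C)) b' d'}
      {P₁ : HPath (Pro (C := C)) a c} {S₁ : HPath (Pro (C := C)) a d}
      (φ : Cell f g R B) {x : CellPath g h P Q} {y : CellPath h k P' Q'} {z : CellPath g k S T}
      (hxyz : IsAppend x y z) (hx : P₁ = R.append P) (hz : S₁ = R.append S) :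
      IsAppend (.cons φ x hx) y (.cons φ z hz)

end Graph

/-- Identity cells and multi-composition.  The frames of a composite are the composites of the
frames; this is recorded by equations. -/
class VirtualDoubleStruct (C : Type u) [Category.{v} C] extends VirtualDoubleGraph.{w, z} C where
  idc : {a b : C} → (A : Pro a b) → Cell (𝟙 a) (𝟙 b) (.one A) A
  comp : {a b a' b' a'' b'' : C} → {f : a ⟶ a'} → {g : b ⟶ b'} → {f' : a' ⟶ a''} →
    {g' : b' ⟶ b''} → {u : a ⟶ a''} → {v : b ⟶ b''} → {P : HPath Pro a b} →
    {Q : HPath Pro a' b'} → {B : Pro a'' b''} →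
    CellPath f g P Q → Cell f' g' Q B → f ≫ f' = u → g ≫ g' = v → Cell u v P B

open VirtualDoubleStruct

section Struct

variable {C : Type u} [Category.{v} C] [VirtualDoubleStruct.{w, z} C]

/-- The string of identity cells on a string of proarrows. -/
def CellPath.ids : {a b : C} → (P : HPath (Pro (C := C)) a b) → CellPath (𝟙 a) (𝟙 b) P P
  | _, _, .nil a => .nil (𝟙 a)
  | _, _, .cons A P => .cons (idc A) (CellPath.ids P) rfl

/-- `VComp x y z`: the string `z` is the vertical composite of the string `x` followed by the
string `y`, i.e. each cell `φ` of `y` is composed with the segment of `x` lying over its source. -/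
inductive VComp : {a b a' b' a'' b'' : C} → {f : a ⟶ a'} → {g : b ⟶ b'} →
    {f' : a' ⟶ a''} → {g' : b' ⟶ b''} → {u : a ⟶ a''} → {v : b ⟶ b''} →
    {P : HPath (Pro (C := C)) a b} → {Q : HPath (Pro (C := C)) a' b'} →
    {R : HPath (Pro (C := C)) a'' b''} →
    CellPath f g P Q → CellPath f' g' Q R → CellPath u v P R → Prop
  | nil {a a' a'' : C} {f : a ⟶ a'} {f' : a' ⟶ a''} {u : a ⟶ a''} (h : f ≫ f' = u) :
      VComp (.nil f) (.nil f') (.nil u)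
  | cons {a b c a' b' c' a'' b'' c'' : C} {f : a ⟶ a'} {g : b ⟶ b'} {h : c ⟶ c'}
      {f' : a' ⟶ a''} {g' : b' ⟶ b''} {h' : c' ⟶ c''}
      {u : a ⟶ a''} {v : b ⟶ b''} {w : c ⟶ c''}
      {P₁ : HPath (Pro (C := C)) a b} {Q₁ : HPath (Pro (C := C)) a' b'} {B : Pro a'' b''}
      {P₂ : HPath (Pro (C := C)) b c} {Q₂ : HPath (Pro (C := C)) b' c'}
      {R : HPath (Pro (C := C)) b'' c''}
      {P : HPath (Pro (C := C)) a c} {Q : HPath (Pro (C := C)) a' c'}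
      {x₁ : CellPath f g P₁ Q₁} {x₂ : CellPath g h P₂ Q₂} {x : CellPath f h P Q}
      {φ : Cell f' g' Q₁ B} {y : CellPath g' h' Q₂ R} {z : CellPath v w P₂ R}
      (hx : IsAppend x₁ x₂ x) (hu : f ≫ f' = u) (hv : g ≫ g' = v) (hz : VComp x₂ y z)
      (hQ : Q = Q₁.append Q₂) (hP : P = P₁.append P₂) :
      VComp x (.cons φ y hQ) (.cons (comp x₁ φ hu hv) z hP)

end Struct

/-- A virtual double category with vertical category `C`. -/
class VirtualDoubleCategory (C : Type u) [Category.{v} C] extends VirtualDoubleStruct.{w, z} C where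
  ids_comp : ∀ {a b a' b' : C} {f : a ⟶ a'} {g : b ⟶ b'} {P : HPath Pro a b} {B : Pro a' b'}
    (φ : Cell f g P B), comp (CellPath.ids P) φ (Category.id_comp f) (Category.id_comp g) = φ
  comp_idc : ∀ {a b a' b' : C} {f : a ⟶ a'} {g : b ⟶ b'} {P : HPath Pro a b} {B : Pro a' b'}
    (φ : Cell f g P B),
    comp (CellPath.one φ) (idc B) (Category.comp_id f) (Category.comp_id g) = φ
  assoc : ∀ {a b a' b' a'' b'' a₃ b₃ : C} {f : a ⟶ a'} {g : b ⟶ b'} {f' : a' ⟶ a''}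
    {g' : b' ⟶ b''} {u : a ⟶ a''} {v : b ⟶ b''} {f'' : a'' ⟶ a₃} {g'' : b'' ⟶ b₃}
    {s : a' ⟶ a₃} {t : b' ⟶ b₃} {p : a ⟶ a₃} {q : b ⟶ b₃}
    {P : HPath Pro a b} {Q : HPath Pro a' b'} {R : HPath Pro a'' b''} {B : Pro a₃ b₃}
    {x : CellPath f g P Q} {y : CellPath f' g' Q R} {z : CellPath u v P R} (ψ : Cell f'' g'' R B)
    (_ : VComp x y z) (hs : f' ≫ f'' = s) (ht : g' ≫ g'' = t) (hp : f ≫ s = p) (hq : g ≫ t = q)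
    (hp' : u ≫ f'' = p) (hq' : v ≫ g'' = q),
    comp x (comp y ψ hs ht) hp hq = comp z ψ hp' hq'

open VirtualDoubleCategory

section Basic

variable {C : Type u} [Category.{v} C] [VirtualDoubleCategory.{w, z} C]

theorem isAppend_append {a b c a' b' c' : C} {f : a ⟶ a'} {g : b ⟶ b'} {h : c ⟶ c'}
    {P : HPath (Pro (C := C)) a b} {Q : HPath (Pro (C := C)) a' b'}
    {P' : HPath (Pro (C := C)) b c} {Q' : HPath (Pro (C := C)) b' c'}
    (x : CellPath f g P Q) (y : CellPath g h P' Q') : IsAppend x y (x.append y) := by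
  induction x with
  | nil f => exact .nil f y
  | cons φ x hS ih => exact .cons φ (ih y) hS _

theorem isAppend_ids {a b c : C} (P : HPath (Pro (C := C)) a b) (Q : HPath (Pro (C := C)) b c) :
    IsAppend (CellPath.ids P) (CellPath.ids Q) (CellPath.ids (P.append Q)) := by
  induction P with
  | nil a => exact .nil _ _
  | cons A P ih => exact .cons _ (ih Q) rfl rfl

theorem isAppend_one {a b c a' b' c' : C} {f : a ⟶ a'} {g : b ⟶ b'} {h : c ⟶ c'}
    {R : HPath (Pro (C := C)) a b} {B : Pro a' b'} {P : HPath (Pro (C := C)) b c}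
    {Q : HPath (Pro (C := C)) b' c'} {S : HPath (Pro (C := C)) a c}
    (φ : Cell f g R B) (φs : CellPath g h P Q) (hS : S = R.append P) :
    IsAppend (.one φ) φs (.cons φ φs hS) :=
  .cons φ (.nil _ _) _ _

theorem VComp.cons' {a b c a' b' c' a'' b'' c'' : C} {f : a ⟶ a'} {g : b ⟶ b'} {h : c ⟶ c'}
      {f' : a' ⟶ a''} {g' : b' ⟶ b''} {h' : c' ⟶ c''}
      {u : a ⟶ a''} {v : b ⟶ b''} {w : c ⟶ c''}
      {P₁ : HPath (Pro (C := C)) a b} {Q₁ : HPath (Pro (C := C)) a' b'} {B : Pro a'' b''}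
      {P₂ : HPath (Pro (C := C)) b c} {Q₂ : HPath (Pro (C := C)) b' c'}
      {R : HPath (Pro (C := C)) b'' c''}
      {P : HPath (Pro (C := C)) a c} {Q : HPath (Pro (C := C)) a' c'}
      {x₁ : CellPath f g P₁ Q₁} {x₂ : CellPath g h P₂ Q₂} {x : CellPath f h P Q}
      {φ : Cell f' g' Q₁ B} {y : CellPath g' h' Q₂ R} {z : CellPath v w P₂ R} {χ : Cell u v P₁ B}
      (hx : IsAppend x₁ x₂ x) (hu : f ≫ f' = u) (hv : g ≫ g' = v) (hχ : comp x₁ φ hu hv = χ)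
      (hz : VComp x₂ y z) (hQ : Q = Q₁.append Q₂) (hP : P = P₁.append P₂) :
      VComp x (.cons φ y hQ) (.cons χ z hP) := by
  subst hχ
  exact .cons hx hu hv hz hQ hP

theorem vcomp_ids {a b a' b' : C} {f : a ⟶ a'} {g : b ⟶ b'} {P : HPath (Pro (C := C)) a b}
    {Q : HPath (Pro (C := C)) a' b'} (x : CellPath f g P Q) : VComp x (CellPath.ids Q) x := by
  induction x with
  | nil f => exact .nil (Category.comp_id f)
  | cons φ x hS ih =>
    exact .cons' (isAppend_one φ x hS) _ _ (comp_idc φ) ih _ hS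

theorem ids_vcomp {a b a' b' : C} {f : a ⟶ a'} {g : b ⟶ b'} {P : HPath (Pro (C := C)) a b}
    {Q : HPath (Pro (C := C)) a' b'} (x : CellPath f g P Q) : VComp (CellPath.ids P) x x := by
  induction x with
  | nil f => exact .nil (Category.id_comp f)
  | cons φ x hS ih =>
    subst hS
    exact .cons' (isAppend_ids _ _) _ _ (ids_comp φ) ih _ rfl

theorem isAppend_nil {a b a' b' : C} {f : a ⟶ a'} {g : b ⟶ b'} {P : HPath (Pro (C := C)) a b}
    {Q : HPath (Pro (C := C)) a' b'} (x : CellPath f g P Q) : IsAppend x (.nil g) x := by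
  induction x with
  | nil f => exact .nil _ _
  | cons φ x hS ih => exact .cons φ ih hS hS

theorem vcomp_one {a b a' b' a'' b'' : C} {f : a ⟶ a'} {g : b ⟶ b'} {f' : a' ⟶ a''}
    {g' : b' ⟶ b''} {u : a ⟶ a''} {v : b ⟶ b''} {P : HPath (Pro (C := C)) a b}
    {Q : HPath (Pro (C := C)) a' b'} {B : Pro a'' b''} (x : CellPath f g P Q) (φ : Cell f' g' Q B)
    (hu : f ≫ f' = u) (hv : g ≫ g' = v) : VComp x (.one φ) (.one (comp x φ hu hv)) := by
  exact .cons (x₂ := .nil g) (P₂ := .nil b) (isAppend_nil x) hu hv (.nil hv) _ _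

theorem vcomp_two {a b c a' b' c' a'' b'' c'' : C} {f : a ⟶ a'} {g : b ⟶ b'} {h : c ⟶ c'}
      {f' : a' ⟶ a''} {g' : b' ⟶ b''} {h' : c' ⟶ c''}
      {u : a ⟶ a''} {v : b ⟶ b''} {w : c ⟶ c''}
      {P₁ : HPath (Pro (C := C)) a b} {Q₁ : HPath (Pro (C := C)) a' b'} {B : Pro a'' b''}
      {P₂ : HPath (Pro (C := C)) b c} {Q₂ : HPath (Pro (C := C)) b' c'} {B' : Pro b'' c''}
      {x₁ : CellPath f g P₁ Q₁} {x₂ : CellPath g h P₂ Q₂}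
      {P : HPath (Pro (C := C)) a c} {Q : HPath (Pro (C := C)) a' c'} {x : CellPath f h P Q}
      {φ : Cell f' g' Q₁ B} {ψ : Cell g' h' Q₂ B'} {χ : Cell u v P₁ B} {ω : Cell v w P₂ B'}
      (hx : IsAppend x₁ x₂ x) (hu : f ≫ f' = u) (hv : g ≫ g' = v) (hw : h ≫ h' = w)
      (hχ : comp x₁ φ hu hv = χ) (hω : comp x₂ ψ hv hw = ω)
      (hQ : Q = Q₁.append Q₂) (hP : P = P₁.append P₂) :
      VComp x (.two φ ψ hQ) (.two χ ω hP) := by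
  subst hχ hω
  exact .cons hx hu hv (vcomp_one x₂ ψ hv hw) _ _

end Basic

section Monoids

variable {C : Type u} [Category.{v} C] [VirtualDoubleCategory.{w, z} C]

/-- A monoid structure over the object `c`. -/
structure MonoidOn (c : C) where
  pro : Pro c c
  one : Cell (𝟙 c) (𝟙 c) (.nil c) pro
  mul : Cell (𝟙 c) (𝟙 c) (.cons pro (.one pro)) pro
  one_mul : comp (P := .one pro) (.two one (idc pro) rfl) mul (Category.id_comp _) (Category.id_comp _) = idc pro
  mul_one : comp (P := .one pro) (.two (idc pro) one rfl) mul (Category.id_comp _) (Category.id_comp _) = idc pro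
  mul_assoc : comp (P := .cons pro (.cons pro (.one pro))) (.two mul (idc pro) rfl) mul
      (Category.id_comp _) (Category.id_comp _) =
    comp (P := .cons pro (.cons pro (.one pro))) (.two (idc pro) mul rfl) mul (Category.id_comp _) (Category.id_comp _)

variable (C) in
/-- Objects of `Mod`: monoids in the virtual double category `C`. -/
structure Mod where
  obj : C
  mon : MonoidOn obj

/-- The underlying proarrow of a monoid. -/
abbrev Mod.pro (M : Mod C) : Pro M.obj M.obj := M.mon.pro

/-- Monoid homomorphisms. -/
structure MonHom (M N : Mod C) where
  hom : M.obj ⟶ N.obj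
  cell : Cell hom hom (.one M.pro) N.pro
  map_one : comp (.one M.mon.one) cell (Category.id_comp hom) (Category.id_comp hom) =
    comp (.nil hom) N.mon.one (Category.comp_id hom) (Category.comp_id hom)
  map_mul : comp (.one M.mon.mul) cell (Category.id_comp hom) (Category.id_comp hom) =
    comp (P := .cons M.pro (.one M.pro)) (.two cell cell rfl) N.mon.mul (Category.comp_id hom) (Category.comp_id hom)

theorem MonHom.ext_comp {M N : Mod C} {F G : MonHom M N} (h : F.hom = G.hom)
    (hc : comp (.one F.cell) (idc N.pro) ((Category.comp_id _).trans h)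
      ((Category.comp_id _).trans h) = G.cell) : F = G := by
  obtain ⟨f, φ, _, _⟩ := F
  obtain ⟨g, ψ, _, _⟩ := G
  dsimp only at h
  subst h
  have : φ = ψ := (comp_idc φ).symm.trans hc
  subst this
  rfl

/-- The identity homomorphism. -/
def MonHom.id (M : Mod C) : MonHom M M where
  hom := 𝟙 _
  cell := idc _
  map_one := by
    rw [comp_idc]
    exact (ids_comp M.mon.one).symm
  map_mul := by
    rw [comp_idc]
    exact (ids_comp M.mon.mul).symm

/-- Composition of homomorphisms. -/
def MonHom.comp {M N K : Mod C} (F : MonHom M N) (G : MonHom N K) : MonHom M K where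
  hom := F.hom ≫ G.hom
  cell := VirtualDoubleStruct.comp (.one F.cell) G.cell rfl rfl
  map_one := by
    rw [assoc G.cell (vcomp_one (.one M.mon.one) F.cell (Category.id_comp _) (Category.id_comp _))
      rfl rfl _ _ rfl rfl, F.map_one,
      ← assoc G.cell (vcomp_one (.nil F.hom) N.mon.one (Category.comp_id _) (Category.comp_id _))
      (Category.id_comp _) (Category.id_comp _) rfl rfl rfl rfl, G.map_one]
    exact assoc _ (.nil rfl) _ _ _ _ _ _
  map_mul := by
    rw [assoc G.cell (vcomp_one (.one M.mon.mul) F.cell (Category.id_comp _) (Category.id_comp _))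
      rfl rfl _ _ rfl rfl, F.map_mul,
      ← assoc G.cell (vcomp_one (P := .cons M.pro (.one M.pro)) (.two F.cell F.cell rfl) N.mon.mul (Category.comp_id _)
        (Category.comp_id _))
      (Category.id_comp _) (Category.id_comp _) rfl rfl rfl rfl, G.map_mul]
    exact assoc _ (vcomp_two (isAppend_one _ _ _) rfl rfl rfl rfl rfl _ _) _ _ _ _ _ _

instance : Category (Mod C) where
  Hom := MonHom
  id := MonHom.id
  comp := MonHom.comp
  id_comp F := MonHom.ext_comp (Category.id_comp F.hom)
    ((assoc _ (vcomp_one _ F.cell rfl rfl) (Category.comp_id _) (Category.comp_id _)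
      (Category.id_comp _) (Category.id_comp _) _ _).symm.trans
      ((congrArg (fun t => VirtualDoubleStruct.comp _ t _ _) (comp_idc F.cell)).trans
        (ids_comp F.cell)))
  comp_id F := MonHom.ext_comp (Category.comp_id F.hom)
    ((assoc _ (vcomp_one (.one F.cell) (idc _) rfl rfl) (Category.comp_id _) (Category.comp_id _)
      (Category.comp_id _) (Category.comp_id _) _ _).symm.trans
      ((congrArg (fun t => VirtualDoubleStruct.comp _ t _ _) (comp_idc (idc _))).trans
        (comp_idc F.cell)))
  assoc F G H := MonHom.ext_comp (Category.assoc F.hom G.hom H.hom)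
    ((assoc _ (vcomp_one (.one (F.comp G).cell) H.cell rfl rfl) (Category.comp_id _)
      (Category.comp_id _) (Category.assoc _ _ _) (Category.assoc _ _ _) _ _).symm.trans
      ((congrArg (fun t => VirtualDoubleStruct.comp _ t _ _) (comp_idc H.cell)).trans
        (assoc H.cell (vcomp_one (.one F.cell) G.cell rfl rfl) rfl rfl rfl rfl _ _).symm))

/-- Bimodules between monoids. -/
structure Bimod (M N : Mod C) where
  pro : Pro M.obj N.obj
  left : Cell (𝟙 _) (𝟙 _) (.cons M.pro (.one pro)) pro
  right : Cell (𝟙 _) (𝟙 _) (.cons pro (.one N.pro)) pro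
  one_left : comp (P := .one pro) (.two M.mon.one (idc pro) rfl) left
      (Category.id_comp _) (Category.id_comp _) = idc pro
  mul_left : comp (P := .cons M.pro (.cons M.pro (.one pro))) (.two M.mon.mul (idc pro) rfl) left
      (Category.id_comp _) (Category.id_comp _) =
    comp (P := .cons M.pro (.cons M.pro (.one pro))) (.two (idc M.pro) left rfl) left
      (Category.id_comp _) (Category.id_comp _)
  right_one : comp (P := .one pro) (.two (idc pro) N.mon.one rfl) right
      (Category.id_comp _) (Category.id_comp _) = idc pro
  right_mul : comp (P := .cons pro (.cons N.pro (.one N.pro))) (.two (idc pro) N.mon.mul rfl) right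
      (Category.id_comp _) (Category.id_comp _) =
    comp (P := .cons pro (.cons N.pro (.one N.pro))) (.two right (idc N.pro) rfl) right
      (Category.id_comp _) (Category.id_comp _)
  left_right : comp (P := .cons M.pro (.cons pro (.one N.pro))) (.two left (idc N.pro) rfl) right
      (Category.id_comp _) (Category.id_comp _) =
    comp (P := .cons M.pro (.cons pro (.one N.pro))) (.two (idc M.pro) right rfl) left
      (Category.id_comp _) (Category.id_comp _)

/-- The string of underlying proarrows of a string of bimodules. -/
def under : {M N : Mod C} → HPath (Bimod (C := C)) M N → HPath (Pro (C := C)) M.obj N.obj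
  | _, _, .nil M => .nil M.obj
  | _, _, .cons A P => .cons A.pro (under P)

theorem under_append {M N K : Mod C} (P : HPath (Bimod (C := C)) M N)
    (Q : HPath (Bimod (C := C)) N K) : under (P.append Q) = (under P).append (under Q) := by
  induction P with
  | nil => rfl
  | cons A P ih => simp only [HPath.append, under, ih]

/-- `InnerPair P x y`: for some adjacent bimodules `A, A'` of the string `P`, with middle monoid
`L`, the strings `x` and `y` from `…, A, L, A', …` to `…, A, A', …` are given by the right action
of `L` on `A`, resp. by the left action of `L` on `A'`. -/
inductive InnerPair : {M N : Mod C} → (P : HPath (Bimod (C := C)) M N) →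
    {W : HPath (Pro (C := C)) M.obj N.obj} →
    CellPath (𝟙 _) (𝟙 _) W (under P) → CellPath (𝟙 _) (𝟙 _) W (under P) → Prop
  | here {M L K N : Mod C} (A : Bimod M L) (A' : Bimod L K) (P : HPath (Bimod (C := C)) K N) :
      InnerPair (.cons A (.cons A' P))
        (W := .cons A.pro (.cons L.pro (.cons A'.pro (under P))))
        (.cons A.right (.cons (idc A'.pro) (.ids (under P)) rfl) rfl)
        (.cons (idc A.pro) (.cons A'.left (.ids (under P)) rfl) rfl)
  | there {M L N : Mod C} (A : Bimod M L) {P : HPath (Bimod (C := C)) L N}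
      {W : HPath (Pro (C := C)) L.obj N.obj} {x y : CellPath (𝟙 _) (𝟙 _) W (under P)}
      (h : InnerPair P x y) :
      InnerPair (.cons A P) (W := .cons A.pro W)
        (.cons (idc A.pro) x rfl) (.cons (idc A.pro) y rfl)

/-- The action of the last monoid on the last bimodule of a nonempty string. -/
def rightAct : {M L N : Mod C} → (A : Bimod M L) → (P : HPath (Bimod (C := C)) L N) →
    CellPath (𝟙 _) (𝟙 _) ((under (.cons A P)).append (.one N.pro)) (under (.cons A P))
  | _, _, _, A, .nil _ => .one A.right
  | _, _, _, A, .cons A' P => .cons (idc A.pro) (rightAct A' P) rfl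

/-- Compatibility of a cell with the outer left actions.  For the empty source, the actions of
the source monoid on the target through the two frames agree. -/
def LeftCompat {M' N' : Mod C} (B : Bimod M' N') : {M N : Mod C} →
    (P : HPath (Bimod (C := C)) M N) → (F : MonHom M M') → (G : MonHom N N') →
    Cell F.hom G.hom (under P) B.pro → Prop
  | M, _, .nil _, F, G, φ =>
      comp (P := .one M.pro) (.two F.cell φ rfl) B.left (Category.comp_id _) (Category.comp_id _) =
        comp (P := .one M.pro) (.two φ G.cell rfl) B.right
          (Category.comp_id _) (Category.comp_id _)
  | M, _, .cons A P, F, _, φ =>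
      comp (P := .cons M.pro (under (.cons A P))) (.cons A.left (.ids (under P)) rfl) φ
          (Category.id_comp _) (Category.id_comp _) =
        comp (P := .cons M.pro (under (.cons A P))) (.two F.cell φ rfl) B.left
          (Category.comp_id _) (Category.comp_id _)

/-- Compatibility of a cell with nonempty source with the outer right actions. -/
def RightCompat {M' N' : Mod C} (B : Bimod M' N') : {M N : Mod C} →
    (P : HPath (Bimod (C := C)) M N) → (F : MonHom M M') → (G : MonHom N N') →
    Cell F.hom G.hom (under P) B.pro → Prop
  | _, _, .nil _, _, _, _ => True
  | _, _, .cons A P, _, G, φ =>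
      comp (rightAct A P) φ (Category.id_comp _) (Category.id_comp _) =
        comp (.two φ G.cell rfl) B.right (Category.comp_id _) (Category.comp_id _)

/-- Compatibility of a cell with the actions of the inner monoids. -/
def InnerCompat {M N : Mod C} (P : HPath (Bimod (C := C)) M N) {a b : C} {f : M.obj ⟶ a}
    {g : N.obj ⟶ b} {B : Pro a b} (φ : Cell f g (under P) B) : Prop :=
  ∀ (W : HPath (Pro (C := C)) M.obj N.obj) (x y : CellPath (𝟙 _) (𝟙 _) W (under P)),
    InnerPair P x y → comp x φ (Category.id_comp f) (Category.id_comp g) =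
      comp y φ (Category.id_comp f) (Category.id_comp g)

/-- 2-cells of `Mod`: bimodule homomorphisms. -/
@[ext]
structure BimodHom {M N M' N' : Mod C} (F : MonHom M M') (G : MonHom N N')
    (P : HPath (Bimod (C := C)) M N) (B : Bimod M' N') where
  cell : Cell F.hom G.hom (under P) B.pro
  left : LeftCompat B P F G cell
  right : RightCompat B P F G cell
  inner : InnerCompat P cell

instance : VirtualDoubleGraph (Mod C) where
  Pro := Bimod
  Cell := BimodHom

end Monoids

section ModComp

variable {C : Type u} [Category.{v} C] [VirtualDoubleCategory.{w, z} C]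

/-- The string of underlying cells of a string of bimodule homomorphisms. -/
def underCells {M N M' N' : Mod C} {F : M ⟶ M'} {G : N ⟶ N'} {P : HPath (Bimod (C := C)) M N}
    {Q : HPath (Bimod (C := C)) M' N'} : CellPath F G P Q →
    CellPath (MonHom.hom F) (MonHom.hom G) (under P) (under Q)
  | .nil F => .nil (MonHom.hom F)
  | .cons φ φs hS => .cons (BimodHom.cell φ) (underCells φs) (by rw [hS]; exact under_append _ _)

/-- One-step moves of an inner monoid past an adjacent pair of cells. -/
inductive Move : {M N : Mod C} → (Q : HPath (Bimod (C := C)) M N) → {a b : C} →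
    {f : a ⟶ M.obj} → {g : b ⟶ N.obj} → {W : HPath (Pro (C := C)) a b} →
    CellPath f g W (under Q) → CellPath f g W (under Q) → Prop
  | here {M L K N : Mod C} (B : Bimod M L) (B' : Bimod L K) (Q : HPath (Bimod (C := C)) K N)
      {a b c d e : C} {f : a ⟶ M.obj} {g : b ⟶ L.obj} {h : c ⟶ L.obj} {k : d ⟶ K.obj}
      {l : e ⟶ N.obj} {R : HPath (Pro (C := C)) a b} {S : HPath (Pro (C := C)) b c}
      {T : HPath (Pro (C := C)) c d} {V : HPath (Pro (C := C)) d e}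
      {RS : HPath (Pro (C := C)) a c} {TV : HPath (Pro (C := C)) c e}
      {ST : HPath (Pro (C := C)) b d} {STV : HPath (Pro (C := C)) b e}
      {W : HPath (Pro (C := C)) a e}
      (φ : Cell f g R B.pro) (χ : Cell g h S L.pro) (φ' : Cell h k T B'.pro)
      (y : CellPath k l V (under Q)) (hRS : RS = R.append S) (hTV : TV = T.append V)
      (hST : ST = S.append T) (hSTV : STV = ST.append V) (hx : W = RS.append TV)
      (hy : W = R.append STV) :
      Move (.cons B (.cons B' Q))
        (.cons (comp (.two φ χ hRS) B.right (Category.comp_id _) (Category.comp_id _))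
          (.cons φ' y hTV) hx)
        (.cons φ (.cons (comp (.two χ φ' hST) B'.left (Category.comp_id _) (Category.comp_id _))
          y hSTV) hy)
  | there {M L N : Mod C} (B : Bimod M L) {Q : HPath (Bimod (C := C)) L N}
      {a b c : C} {f : a ⟶ M.obj} {g : b ⟶ L.obj} {h : c ⟶ N.obj}
      {R : HPath (Pro (C := C)) a b} {V : HPath (Pro (C := C)) b c} {W : HPath (Pro (C := C)) a c}
      (φ : Cell f g R B.pro) {x y : CellPath g h V (under Q)} (hxy : Move Q x y)
      (hW : W = R.append V) : Move (.cons B Q) (.cons φ x hW) (.cons φ y hW)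

theorem Move.exists_innerPair {M N : Mod C} {Q : HPath (Bimod (C := C)) M N} {a b : C}
    {f : a ⟶ M.obj} {g : b ⟶ N.obj} {W : HPath (Pro (C := C)) a b}
    {x y : CellPath f g W (under Q)} (h : Move Q x y) :
    ∃ (V : HPath (Pro (C := C)) M.obj N.obj) (p q : CellPath (𝟙 _) (𝟙 _) V (under Q))
      (t : CellPath f g W V), InnerPair Q p q ∧ VComp t p x ∧ VComp t q y := by
  induction h with
  | @here M L K N B B' Q a b c d e f g h k l R S T V RS TV ST STV W φ χ φ' y hRS hTV hST hSTV hx hy =>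
    refine ⟨_, _, _, .cons φ (.cons (S := STV) χ (.cons φ' y hTV) ?_) hy,
      .here B B' Q, ?_, ?_⟩
    · rw [hSTV, hST, hTV, HPath.append_assoc]
    · refine .cons (x₁ := .two φ χ hRS) ?_ _ _ (vcomp_ids (.cons φ' y hTV)) _ _
      exact .cons _ (isAppend_one χ _ _) _ _
    · refine .cons' (isAppend_one φ _ _) (Category.comp_id _) (Category.comp_id _) (comp_idc φ)
        ?_ _ _
      refine .cons (x₁ := .two χ φ' hST) ?_ _ _ (vcomp_ids y) _ _
      exact .cons _ (isAppend_one φ' _ _) _ _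
  | there B φ hxy hW ih =>
    obtain ⟨V, p, q, t, h, h1, h2⟩ := ih
    exact ⟨_, _, _, .cons φ t hW, .there B h,
      .cons' (isAppend_one φ _ _) (Category.comp_id _) (Category.comp_id _) (comp_idc φ) h1 _ _,
      .cons' (isAppend_one φ _ _) (Category.comp_id _) (Category.comp_id _) (comp_idc φ) h2 _ _⟩

/-- The equivalence relation generated by moves. -/
abbrev Moves {M N : Mod C} (Q : HPath (Bimod (C := C)) M N) {a b : C}
    {f : a ⟶ M.obj} {g : b ⟶ N.obj} {W : HPath (Pro (C := C)) a b} :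
    CellPath f g W (under Q) → CellPath f g W (under Q) → Prop :=
  Relation.EqvGen (Move Q)

theorem Moves.comp_eq {M N : Mod C} {Q : HPath (Bimod (C := C)) M N} {a b a' b' : C}
    {f : a ⟶ M.obj} {g : b ⟶ N.obj} {W : HPath (Pro (C := C)) a b}
    {x y : CellPath f g W (under Q)} (h : Moves Q x y) {f' : M.obj ⟶ a'} {g' : N.obj ⟶ b'}
    {B : Pro a' b'} {ψ : Cell f' g' (under Q) B} (hψ : InnerCompat Q ψ) {p : a ⟶ a'} {q : b ⟶ b'}
    (hp : f ≫ f' = p) (hq : g ≫ g' = q) : comp x ψ hp hq = comp y ψ hp hq := by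
  induction h with
  | rel x y h =>
    obtain ⟨V, s, t, r, hst, h1, h2⟩ := h.exists_innerPair
    rw [← assoc ψ h1 (Category.id_comp f') (Category.id_comp g') hp hq,
      ← assoc ψ h2 (Category.id_comp f') (Category.id_comp g') hp hq, hψ _ _ _ hst]
  | refl x => rfl
  | symm x y _ ih => exact ih.symm
  | trans x y z _ _ ih1 ih2 => exact ih1.trans ih2

theorem Moves.cons {M L N : Mod C} (B : Bimod M L) {Q : HPath (Bimod (C := C)) L N}
    {a b c : C} {f : a ⟶ M.obj} {g : b ⟶ L.obj} {h : c ⟶ N.obj}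
    {R : HPath (Pro (C := C)) a b} {V : HPath (Pro (C := C)) b c} {W : HPath (Pro (C := C)) a c}
    (φ : Cell f g R B.pro) {x y : CellPath g h V (under Q)} (hxy : Moves Q x y)
    (hW : W = R.append V) :
    Moves (.cons B Q) (CellPath.cons φ x hW) (CellPath.cons φ y hW) := by
  induction hxy with
  | rel x y h => exact .rel _ _ (.there B φ h hW)
  | refl x => exact .refl _
  | symm x y _ ih => exact .symm _ _ ih
  | trans x y z _ _ ih1 ih2 => exact .trans _ _ _ ih1 ih2

/-- Pushing the first monoid from the left onto the first proarrow. -/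
theorem left_push {K N K' N' : Mod C} {H : K ⟶ K'} {G : N ⟶ N'}
    {P' : HPath (Bimod (C := C)) K N} {Q : HPath (Bimod (C := C)) K' N'}
    (φs : CellPath H G P' Q) :
    ∀ {M M' L : Mod C} {F : M ⟶ M'} {R : HPath (Bimod (C := C)) M K} {B : Bimod M' K'}
      (φ : BimodHom F H R B) (A : Bimod M L) (P : HPath (Bimod (C := C)) L N)
      (hS : HPath.cons A P = R.append P') (T : HPath (Pro (C := C)) M.obj K.obj)
      (hT : T = (HPath.one M.pro).append (under R))
      (hW : HPath.cons M.pro (under (.cons A P)) = T.append (under P')),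
      ∃ x, VComp (P := .cons M.pro (under (.cons A P))) (.cons A.left (.ids (under P)) rfl)
          (underCells (.cons (C := Mod C) φ φs hS)) x ∧
        Moves (.cons B Q) x (.cons (comp (.two (MonHom.cell F) φ.cell hT) B.left
          (Category.comp_id _) (Category.comp_id _)) (underCells φs) hW) := by
  induction φs with
  | nil H =>
    intro M M' L F R B φ A P hS T hT hW
    rw [HPath.append_nil] at hS
    subst hS hT
    refine ⟨_, .cons' (isAppend_nil _) (Category.id_comp _) (Category.id_comp _) φ.left
      (.nil (Category.id_comp _)) _ hW, .refl _⟩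
  | @cons K K₁ N K' K₁' N' H H₁ G R' B' P'' Q S φ' φs hS' ih =>
    intro M M' L F R B φ A P hS T hT hW
    cases R with
    | nil =>
      simp only [HPath.append] at hS
      subst hS
      have hl := φ.left
      simp only [LeftCompat] at hl
      subst hT
      obtain ⟨x, hx, hm⟩ := ih φ' A P hS' _ rfl
        (by rw [HPath.append_assoc, ← under_append, ← hS']; rfl)
      refine ⟨.cons φ.cell x rfl, .cons' (.nil _ _) (Category.id_comp _) (Category.id_comp _)
        (ids_comp φ.cell) hx _ rfl, .trans _ _ _ (Moves.cons B φ.cell hm rfl) (.symm _ _ ?_)⟩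
      have hm' := Move.here B B' Q φ.cell (MonHom.cell H) φ'.cell (underCells φs)
        (RS := .one _) rfl (by rw [hS']; exact under_append _ _) rfl
        (by rw [HPath.append_assoc, ← under_append, ← hS']; rfl) hW rfl
      rw [← hl] at hm'
      exact .rel _ _ hm'
    | cons A₁ R =>
      simp only [HPath.append] at hS
      cases hS
      subst hT
      refine ⟨_, .cons' ?_ (Category.id_comp _) (Category.id_comp _) φ.left
        (ids_vcomp _) _ hW, .refl _⟩
      exact .cons _ (under_append R _ ▸ isAppend_ids _ _) rfl _

theorem IsAppend.source_eq {a b c a' b' c' : C} {f : a ⟶ a'} {g : b ⟶ b'} {h : c ⟶ c'}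
    {P : HPath (Pro (C := C)) a b} {Q : HPath (Pro (C := C)) a' b'}
    {P' : HPath (Pro (C := C)) b c} {Q' : HPath (Pro (C := C)) b' c'}
    {S : HPath (Pro (C := C)) a c} {T : HPath (Pro (C := C)) a' c'}
    {x : CellPath f g P Q} {y : CellPath g h P' Q'} {t : CellPath f h S T}
    (ht : IsAppend x y t) : S = P.append P' := by
  induction ht with
  | nil => rfl
  | cons φ hxyz hx hz ih => rw [hz, ih, hx, HPath.append_assoc]

theorem isAppend_ids_under {M N K : Mod C} (P : HPath (Bimod (C := C)) M N)
    (Q : HPath (Bimod (C := C)) N K) :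
    IsAppend (CellPath.ids (under P)) (CellPath.ids (under Q)) (CellPath.ids (under (P.append Q))) :=
  under_append P Q ▸ isAppend_ids _ _

theorem isAppend_rightAct {M N K L L' : Mod C} (R : HPath (Bimod (C := C)) M K) (A' : Bimod K L')
    (P' : HPath (Bimod (C := C)) L' N) : ∀ (A : Bimod M L) (P : HPath (Bimod (C := C)) L N)
    (_ : HPath.cons A P = R.append (.cons A' P')),
    IsAppend (CellPath.ids (under R)) (rightAct A' P') (rightAct A P) := by
  induction R generalizing L with
  | nil => intro A P h; cases h; exact .nil _ _
  | cons A₁ R ih =>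
    intro A P h
    simp only [HPath.append] at h
    cases h
    cases R with
    | nil => exact .cons _ (ih A' A' P' rfl) _ _
    | cons A₂ R => exact .cons _ (ih A' A₂ _ rfl) _ _

/-- The empty string. -/
def HPath.IsNil {D : Type u} {E : D → D → Type w} : {a b : D} → HPath E a b → Prop
  | _, _, .nil _ => True
  | _, _, .cons _ _ => False

/-- Pushing a monoid to the right end through cells with empty source. -/
theorem nil_push {K N K' N' : Mod C} {H : K ⟶ K'} {G : N ⟶ N'}
    {P' : HPath (Bimod (C := C)) K N} {Q : HPath (Bimod (C := C)) K' N'}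
    (φs : CellPath H G P' Q) (hP : P'.IsNil) :
    ∀ {M M' : Mod C} {F : M ⟶ M'} {R S : HPath (Bimod (C := C)) M _} {B : Bimod M' K'}
      (φ : BimodHom F H R B) (hS : S = R.append P') (T : HPath (Pro (C := C)) M.obj K.obj)
      (hT : T = (under R).append (.one K.pro))
      (hW : (under S).append (.one N.pro) = T.append (under P')),
      ∃ y, VComp ((underCells (.cons (C := Mod C) φ φs hS)).append (.one (MonHom.cell G)))
          (rightAct B Q) y ∧
        Moves (.cons B Q) (.cons (comp (.two φ.cell (MonHom.cell H) hT) B.right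
          (Category.comp_id _) (Category.comp_id _)) (underCells φs) hW) y := by
  induction φs with
  | nil H =>
    intro M M' F R S B φ hS T hT hW
    rw [HPath.append_nil] at hS
    subst hS hT
    refine ⟨_, .cons (isAppend_nil _) (Category.comp_id _) (Category.comp_id _)
      (.nil (Category.comp_id _)) _ hW, .refl _⟩
  | @cons K K₁ N K' K₁' N' H H₁ G R' B' P'' Q S' φ' φs hS' ih =>
    intro M M' F R S B φ hS T hT hW
    cases R' with
    | cons A R' => subst hS'; exact hP.elim
    | nil =>
      simp only [HPath.append] at hS'
      subst hS'
      cases S' with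
      | cons => exact hP.elim
      | nil =>
        obtain ⟨y, hy, hm⟩ := ih trivial φ' rfl (.one _) rfl rfl
        have hl := φ'.left
        simp only [LeftCompat] at hl
        have h0 : (under S).append (.one K.pro) = (under R).append (.one K.pro) := by
          rw [hS, HPath.append_nil]
        refine ⟨.cons φ.cell y h0, .cons' (isAppend_one _ _ _)
          (Category.comp_id _) (Category.comp_id _) (comp_idc φ.cell) hy _ _,
          .trans _ _ _ ?_ (Moves.cons B φ.cell hm h0)⟩
        have hm' := Move.here B B' Q φ.cell (MonHom.cell H) φ'.cell (underCells φs)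
          hT rfl (ST := .one _) rfl rfl hW h0
        rw [hl] at hm'
        exact .rel _ _ hm'

theorem right_push {K N K' N' : Mod C} {H : K ⟶ K'} {G : N ⟶ N'}
    {P' : HPath (Bimod (C := C)) K N} {Q : HPath (Bimod (C := C)) K' N'}
    (φs : CellPath H G P' Q) :
    ∀ {M M' L : Mod C} {F : M ⟶ M'} {R : HPath (Bimod (C := C)) M K} {B : Bimod M' K'}
      (φ : BimodHom F H R B) (A : Bimod M L) (P : HPath (Bimod (C := C)) L N)
      (hS : HPath.cons A P = R.append P'),
      ∃ x y : CellPath (MonHom.hom F) (MonHom.hom G) _ (under (.cons B Q)),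
        VComp (rightAct A P) (underCells (.cons (C := Mod C) φ φs hS)) x ∧
        VComp ((underCells (.cons (C := Mod C) φ φs hS)).append (.one (MonHom.cell G)))
          (rightAct B Q) y ∧ Moves (.cons B Q) x y := by
  have key : ∀ {K K' N N' : Mod C} {H : K ⟶ K'} {G : N ⟶ N'} {P' : HPath (Bimod (C := C)) K N}
      {Q : HPath (Bimod (C := C)) K' N'} (φs : CellPath H G P' Q) (_ : P'.IsNil)
      {M M' L : Mod C} {F : M ⟶ M'} {R : HPath (Bimod (C := C)) M K} {B : Bimod M' K'}
      (φ : BimodHom F H R B) (A : Bimod M L) (P : HPath (Bimod (C := C)) L N)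
      (hS : HPath.cons A P = R.append P'),
      ∃ x y : CellPath (MonHom.hom F) (MonHom.hom G) _ (under (.cons B Q)),
        VComp (rightAct A P) (underCells (.cons (C := Mod C) φ φs hS)) x ∧
        VComp ((underCells (.cons (C := Mod C) φ φs hS)).append (.one (MonHom.cell G)))
          (rightAct B Q) y ∧ Moves (.cons B Q) x y := by
    intro K K' N N' H G P' Q φs hP M M' L F R B φ A P hS
    cases P' with
    | cons => exact hP.elim
    | nil =>
      have hR : R = .cons A P := by rw [hS, HPath.append_nil]
      subst hR
      have h0 : (under (HPath.cons A P)).append (.one K.pro) =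
        ((under (HPath.cons A P)).append (.one K.pro)).append (.nil _) :=
        (HPath.append_nil _).symm
      obtain ⟨y, hy, hm⟩ := nil_push φs trivial φ hS _ rfl h0
      exact ⟨_, y, .cons' (isAppend_nil _) (Category.id_comp _) (Category.id_comp _) φ.right
        (ids_vcomp _) _ h0, hy, hm⟩
  induction φs with
  | nil H => exact key (.nil H) trivial
  | @cons K K₁ N K' K₁' N' H H₁ G R' B' P'' Q S' φ' φs hS' ih =>
    intro M M' L F R B φ A P hS
    cases S' with
    | nil => exact key (.cons φ' φs hS') trivial φ A P hS
    | cons A' P₁ =>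
      obtain ⟨x, y, hx, hy, hm⟩ := ih φ' A' P₁ hS'
      have h0 : (under (HPath.cons A P)).append (.one N.pro) =
          (under R).append ((under (HPath.cons A' P₁)).append (.one N.pro)) := by
        rw [hS, under_append, HPath.append_assoc]
      exact ⟨.cons φ.cell x h0, .cons φ.cell y h0,
        .cons' (isAppend_rightAct R A' P₁ A P hS) (Category.id_comp _) (Category.id_comp _)
          (ids_comp φ.cell) hx _ _,
        .cons' (isAppend_one _ _ _) (Category.comp_id _) (Category.comp_id _) (comp_idc φ.cell)
          hy _ _, Moves.cons B φ.cell hm h0⟩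

theorem InnerPair.split {M N K : Mod C} (R : HPath (Bimod (C := C)) M K)
    (P' : HPath (Bimod (C := C)) K N) : ∀ {S : HPath (Bimod (C := C)) M N}
    {W : HPath (Pro (C := C)) M.obj N.obj} {p q : CellPath (𝟙 _) (𝟙 _) W (under S)}
    (_ : InnerPair S p q) (_ : S = R.append P'),
    (∃ (V : HPath (Pro (C := C)) M.obj K.obj) (p' q' : CellPath (𝟙 _) (𝟙 _) V (under R)),
      InnerPair R p' q' ∧ IsAppend p' (.ids (under P')) p ∧ IsAppend q' (.ids (under P')) q) ∨
    (∃ (V : HPath (Pro (C := C)) K.obj N.obj) (p' q' : CellPath (𝟙 _) (𝟙 _) V (under P')),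
      InnerPair P' p' q' ∧ IsAppend (.ids (under R)) p' p ∧ IsAppend (.ids (under R)) q' q) ∨
    (∃ (L L' : Mod C) (A : Bimod M L) (R₀ : HPath (Bimod (C := C)) L K) (A' : Bimod K L')
      (P₀ : HPath (Bimod (C := C)) L' N) (_ : R = .cons A R₀) (_ : P' = .cons A' P₀),
      IsAppend (rightAct A R₀) (.ids (under P')) p ∧
      IsAppend (P' := .cons K.pro (under (.cons A' P₀))) (.ids (under R))
        (.cons A'.left (.ids (under P₀)) rfl) q) := by
  induction R with
  | nil => 
    intro S W p q h hS
    simp only [HPath.append] at hS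
    subst hS
    exact .inr (.inl ⟨_, p, q, h, .nil _ _, .nil _ _⟩)
  | cons A R ih =>
    intro S W p q h hS
    simp only [HPath.append] at hS
    cases h with
    | here A₁ A₂ P₂ =>
      cases R with
      | nil =>
        simp only [HPath.append] at hS
        cases hS
        refine .inr (.inr ⟨_, _, A, .nil _, A₂, P₂, rfl, rfl, ?_, ?_⟩)
        · exact isAppend_one _ _ _
        · exact isAppend_one _ _ _
      | cons A₃ R =>
        simp only [HPath.append] at hS
        cases hS
        refine .inl ⟨_, _, _, .here A A₂ R, ?_, ?_⟩
        · exact .cons _ (.cons _ (isAppend_ids_under _ _) _ _) _ _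
        · exact .cons _ (.cons _ (isAppend_ids_under _ _) _ _) _ _
    | there A₁ h =>
      cases hS
      rcases ih P' h rfl with ⟨V, p', q', h, hp, hq⟩ | ⟨V, p', q', h, hp, hq⟩ |
        ⟨L, L', A₁, R₀, A', P₀, hR, hP, hp, hq⟩
      · exact .inl ⟨_, _, _, .there A h, .cons _ hp _ _, .cons _ hq _ _⟩
      · exact .inr (.inl ⟨_, _, _, h, .cons _ hp _ _, .cons _ hq _ _⟩)
      · subst hR
        exact .inr (.inr ⟨_, _, A, _, A', P₀, rfl, hP, .cons _ hp _ _, .cons _ hq _ _⟩)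

theorem inner_push {M N M' N' : Mod C} {F : M ⟶ M'} {G : N ⟶ N'}
    {S : HPath (Bimod (C := C)) M N} {Q : HPath (Bimod (C := C)) M' N'}
    (φs : CellPath F G S Q) :
    ∀ {W : HPath (Pro (C := C)) M.obj N.obj} {p q : CellPath (𝟙 _) (𝟙 _) W (under S)}
    (_ : InnerPair S p q), ∃ x y : CellPath (MonHom.hom F) (MonHom.hom G) W (under Q),
      VComp p (underCells φs) x ∧ VComp q (underCells φs) y ∧ Moves Q x y := by
  induction φs with
  | nil F => intro W p q h; cases h
  | @cons M K N M' K' N' F H G R B P' Q S φ φs hS ih =>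
    intro W p q h
    rcases h.split R P' hS with ⟨V, p', q', h, hp, hq⟩ | ⟨V, p', q', h, hp, hq⟩ |
        ⟨L, L', A, R₀, A', P₀, hR, hP, hp, hq⟩
    · refine ⟨_, _, .cons' hp (Category.id_comp _) (Category.id_comp _) (φ.inner _ _ _ h)
        (ids_vcomp _) _ hp.source_eq, .cons hq (Category.id_comp _) (Category.id_comp _)
        (ids_vcomp _) _ hp.source_eq, .refl _⟩
    · obtain ⟨x, y, hx, hy, hm⟩ := ih h
      exact ⟨_, _, .cons' hp (Category.id_comp _) (Category.id_comp _) (ids_comp φ.cell) hx _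
        hp.source_eq, .cons' hq (Category.id_comp _) (Category.id_comp _) (ids_comp φ.cell) hy _
        hp.source_eq, Moves.cons B φ.cell hm _⟩
    · subst hR hP
      cases φs with
      | @cons _ K₁ _ _ K₁' _ _ H₁ _ R' B' P'' Q _ φ' φs hS' =>
        obtain ⟨x, hx, hm⟩ := left_push φs φ' A' P₀ hS' _ rfl
          (by rw [HPath.append_assoc, ← under_append, ← hS']; rfl)
        refine ⟨_, _, .cons' hp (Category.id_comp _) (Category.id_comp _) φ.right
          (ids_vcomp _) _ hp.source_eq, .cons' hq (Category.id_comp _) (Category.id_comp _)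
          (ids_comp φ.cell) hx _ hq.source_eq,
          .trans _ _ _ ?_ (.symm _ _ (Moves.cons B φ.cell hm _))⟩
        exact .rel _ _ (Move.here B B' Q φ.cell (MonHom.cell H) φ'.cell (underCells φs)
          rfl (by rw [hS']; exact under_append _ _) rfl
          (by rw [HPath.append_assoc, ← under_append, ← hS']; rfl) _ _)

theorem hom_comp_eq {M N K : Mod C} {F : M ⟶ N} {G : N ⟶ K} {H : M ⟶ K} (h : F ≫ G = H) :
    MonHom.hom F ≫ MonHom.hom G = MonHom.hom H := by
  subst h; rfl

theorem cell_comp_eq {M N K : Mod C} {F : M ⟶ N} {G : N ⟶ K} {H : M ⟶ K} (h : F ≫ G = H) :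
    comp (.one (MonHom.cell F)) (MonHom.cell G) (hom_comp_eq h) (hom_comp_eq h) =
      MonHom.cell H := by
  subst h; rfl

theorem left_target {M K N M' K' N' M'' N'' : Mod C} {F : M ⟶ M'} {H : K ⟶ K'} {G : N ⟶ N'}
    {F' : M' ⟶ M''} {G' : N' ⟶ N''} {U : M ⟶ M''} {V : N ⟶ N''}
    {R : HPath (Bimod (C := C)) M K} {B' : Bimod M' K'} {P' : HPath (Bimod (C := C)) K N}
    {Q : HPath (Bimod (C := C)) K' N'} {S : HPath (Bimod (C := C)) M N} {B : Bimod M'' N''}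
    (φ : BimodHom F H R B') (φs : CellPath H G P' Q) (hS : S = R.append P')
    (ψ : BimodHom F' G' (.cons B' Q) B) (hU : F ≫ F' = U) (hV : G ≫ G' = V)
    {W : HPath (Pro (C := C)) M.obj N.obj} (hW : W = (HPath.one M.pro).append (under S))
    {T : HPath (Pro (C := C)) M.obj K.obj} (hT : T = (HPath.one M.pro).append (under R))
    (hW' : W = T.append (under P')) :
    comp (.two (MonHom.cell U) (comp (underCells (.cons (C := Mod C) φ φs hS)) ψ.cell
      (hom_comp_eq hU) (hom_comp_eq hV)) hW) B.left (Category.comp_id _) (Category.comp_id _) =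
    comp (.cons (comp (.two (MonHom.cell F) φ.cell hT) B'.left (Category.comp_id _)
      (Category.comp_id _)) (underCells φs) hW') ψ.cell (hom_comp_eq hU) (hom_comp_eq hV) := by
  have h1 := assoc B.left (vcomp_two
    (isAppend_one (MonHom.cell F) (underCells (.cons (C := Mod C) φ φs hS)) hW)
    (hom_comp_eq hU) (hom_comp_eq hU) (hom_comp_eq hV) (cell_comp_eq hU) (ω := comp _ ψ.cell _ _) rfl
    rfl hW)
    (Category.comp_id _) (Category.comp_id _) (hom_comp_eq hU) (hom_comp_eq hV)
    (Category.comp_id _) (Category.comp_id _)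
  have h2 := assoc (p := MonHom.hom U) (q := MonHom.hom V) ψ.cell
    (VComp.cons (x := .cons (MonHom.cell F) (underCells (.cons (C := Mod C) φ φs hS)) hW)
    (φ := B'.left) (x₁ := .two (MonHom.cell F) φ.cell hT) (x₂ := underCells φs)
    (.cons _ (isAppend_one _ _ _) _ _) (Category.comp_id _) (Category.comp_id _)
    (vcomp_ids _) rfl hW') (Category.id_comp _) (Category.id_comp _) (hom_comp_eq hU)
    (hom_comp_eq hV) (hom_comp_eq hU) (hom_comp_eq hV)
  exact h1.symm.trans ((congrArg (fun t => comp _ t _ _) ψ.left.symm).trans h2)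

theorem right_target {M N M' K' N' M'' N'' : Mod C} {F : M ⟶ M'} {G : N ⟶ N'}
    {F' : M' ⟶ M''} {G' : N' ⟶ N''} {U : M ⟶ M''} {V : N ⟶ N''}
    {B' : Bimod M' K'} {Q : HPath (Bimod (C := C)) K' N'} {S : HPath (Bimod (C := C)) M N}
    {B : Bimod M'' N''} (φs : CellPath F G S (.cons B' Q))
    (ψ : BimodHom F' G' (.cons B' Q) B) (hU : F ≫ F' = U) (hV : G ≫ G' = V)
    {y : CellPath (MonHom.hom F) (MonHom.hom G) _ (under (.cons B' Q))}
    (hy : VComp ((underCells φs).append (.one (MonHom.cell G))) (rightAct B' Q) y) :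
    comp (.two (comp (underCells φs) ψ.cell (hom_comp_eq hU) (hom_comp_eq hV)) (MonHom.cell V)
      rfl) B.right (Category.comp_id _) (Category.comp_id _) =
    comp y ψ.cell (hom_comp_eq hU) (hom_comp_eq hV) := by
  have h1 := assoc B.right (vcomp_two
    (isAppend_append (underCells φs) (.one (MonHom.cell G)))
    (hom_comp_eq hU) (hom_comp_eq hV) (hom_comp_eq hV) (χ := comp _ ψ.cell _ _) rfl
    (cell_comp_eq hV) rfl rfl)
    (Category.comp_id _) (Category.comp_id _) (hom_comp_eq hU) (hom_comp_eq hV)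
    (Category.comp_id _) (Category.comp_id _)
  have h2 := assoc (p := MonHom.hom U) (q := MonHom.hom V) ψ.cell hy
    (Category.id_comp _) (Category.id_comp _) (hom_comp_eq hU)
    (hom_comp_eq hV) (hom_comp_eq hU) (hom_comp_eq hV)
  exact h1.symm.trans ((congrArg (fun t => comp _ t _ _) ψ.right.symm).trans h2)

/-- Composition of 2-cells in `Mod`. -/
def BimodHom.comp {M N M' N' M'' N'' : Mod C} {F : M ⟶ M'} {G : N ⟶ N'} {F' : M' ⟶ M''}
    {G' : N' ⟶ N''} {U : M ⟶ M''} {V : N ⟶ N''} {P : HPath (Bimod (C := C)) M N}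
    {Q : HPath (Bimod (C := C)) M' N'} {B : Bimod M'' N''} (φs : CellPath F G P Q)
    (ψ : BimodHom F' G' Q B) (hU : F ≫ F' = U) (hV : G ≫ G' = V) : BimodHom U V P B where
  cell := VirtualDoubleStruct.comp (underCells φs) ψ.cell (hom_comp_eq hU) (hom_comp_eq hV)
  left := by
    cases φs with
    | nil =>
      have h1 := assoc (p := MonHom.hom U) (q := MonHom.hom V) B.left (vcomp_two
        (isAppend_one (MonHom.cell F) (.nil (MonHom.hom F)) rfl)
        (hom_comp_eq hU) (hom_comp_eq hU) (hom_comp_eq hV) (cell_comp_eq hU)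
        (ψ := ψ.cell) rfl rfl rfl)
        (Category.comp_id _) (Category.comp_id _) (hom_comp_eq hU) (hom_comp_eq hV)
        (Category.comp_id _) (Category.comp_id _)
      have h2 := assoc (p := MonHom.hom U) (q := MonHom.hom V) B.right (vcomp_two
        (IsAppend.nil (MonHom.hom F) (.one (MonHom.cell F)))
        (hom_comp_eq hU) (hom_comp_eq hV) (hom_comp_eq hV) (φ := ψ.cell) rfl
        (cell_comp_eq hV) rfl rfl)
        (Category.comp_id _) (Category.comp_id _) (hom_comp_eq hU) (hom_comp_eq hV)
        (Category.comp_id _) (Category.comp_id _)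
      exact h1.symm.trans ((congrArg (fun t => VirtualDoubleStruct.comp _ t _ _) ψ.left).trans h2)
    | @cons M K N M' K' N' F H G R B' P' Q _ φ φs hS =>
      cases P with
      | nil =>
        cases R with
        | cons => simp only [HPath.append] at hS; cases hS
        | nil =>
          simp only [HPath.append] at hS
          subst hS
          have hl := φ.left
          simp only [LeftCompat] at hl
          obtain ⟨y, hy, hm⟩ := nil_push φs trivial φ rfl (.one _) rfl rfl
          refine (left_target φ φs rfl ψ hU hV rfl (T := .one _) rfl rfl).trans
            (.trans ?_ (right_target (.cons φ φs rfl) ψ hU hV hy).symm)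
          rw [hl]
          exact hm.comp_eq ψ.inner _ _
      | cons A P =>
        have hW : HPath.cons M.pro (under (.cons A P)) =
            ((HPath.one M.pro).append (under R)).append (under P') := by
          rw [HPath.append_assoc, ← under_append, ← hS]; rfl
        obtain ⟨x, hx, hm⟩ := left_push φs φ A P hS _ rfl hW
        exact (assoc ψ.cell hx _ _ _ _ _ _).trans ((hm.comp_eq ψ.inner _ _).trans
          (left_target φ φs hS ψ hU hV rfl rfl hW).symm)
  right := by
    cases P with
    | nil => trivial
    | cons A P =>
      cases φs with
      | cons φ φs hS =>
        obtain ⟨x, y, hx, hy, hm⟩ := right_push φs φ A P hS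
        exact (assoc ψ.cell hx _ _ _ _ _ _).trans ((hm.comp_eq ψ.inner _ _).trans
          (right_target (.cons φ φs hS) ψ hU hV hy).symm)
  inner := by
    intro W x y h
    obtain ⟨x', y', hx, hy, hm⟩ := inner_push φs h
    exact (assoc ψ.cell hx _ _ _ _ _ _).trans ((hm.comp_eq ψ.inner (hom_comp_eq hU)
      (hom_comp_eq hV)).trans (assoc ψ.cell hy _ _ _ _ _ _).symm)

/-- Identity 2-cells in `Mod`. -/
def BimodHom.id {M N : Mod C} (A : Bimod M N) : BimodHom (𝟙 M) (𝟙 N) (.one A) A where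
  cell := idc A.pro
  left := (comp_idc A.left).trans (ids_comp A.left).symm
  right := (comp_idc A.right).trans (ids_comp A.right).symm
  inner := by
    intro W x y h
    cases h with
    | there A h => cases h

instance : VirtualDoubleStruct (Mod C) where
  idc := BimodHom.id
  comp := BimodHom.comp

theorem underCells_ids {M N : Mod C} (P : HPath (Bimod (C := C)) M N) :
    underCells (CellPath.ids (C := Mod C) P) = CellPath.ids (under P) := by
  induction P with
  | nil => rfl
  | cons A P ih => exact congrArg (fun t => CellPath.cons (idc A.pro) t rfl) ih

theorem isAppend_underCells {M N K M' N' K' : Mod C} {F : M ⟶ M'} {G : N ⟶ N'} {H : K ⟶ K'}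
    {P : HPath (Bimod (C := C)) M N} {Q : HPath (Bimod (C := C)) M' N'}
    {P' : HPath (Bimod (C := C)) N K} {Q' : HPath (Bimod (C := C)) N' K'}
    {S : HPath (Bimod (C := C)) M K} {T : HPath (Bimod (C := C)) M' K'}
    {x : CellPath F G P Q} {y : CellPath G H P' Q'} {t : CellPath F H S T}
    (h : IsAppend x y t) : IsAppend (underCells x) (underCells y) (underCells t) := by
  induction h with
  | nil => exact .nil _ _
  | cons φ _ hx hz ih => exact .cons _ ih _ _

theorem vcomp_underCells {M N M' N' M'' N'' : Mod C} {F : M ⟶ M'} {G : N ⟶ N'} {F' : M' ⟶ M''}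
    {G' : N' ⟶ N''} {U : M ⟶ M''} {V : N ⟶ N''} {P : HPath (Bimod (C := C)) M N}
    {Q : HPath (Bimod (C := C)) M' N'} {R : HPath (Bimod (C := C)) M'' N''}
    {x : CellPath F G P Q} {y : CellPath F' G' Q R} {t : CellPath U V P R}
    (h : VComp x y t) : VComp (underCells x) (underCells y) (underCells t) := by
  induction h with
  | nil h => exact .nil (hom_comp_eq h)
  | cons hx hu hv hz hQ hP ih =>
    exact .cons (isAppend_underCells hx) (hom_comp_eq hu) (hom_comp_eq hv) ih _ _

/-- The virtual double category of monoids and modules. -/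
instance : VirtualDoubleCategory (Mod C) where
  ids_comp φ := by
    refine BimodHom.ext (.trans ?_ (ids_comp (BimodHom.cell φ)))
    exact congrArg (fun t => comp t _ _ _) (underCells_ids _)
  comp_idc φ := BimodHom.ext (comp_idc (BimodHom.cell φ))
  assoc ψ h hs ht hp hq hp' hq' := BimodHom.ext
    (assoc (BimodHom.cell ψ) (vcomp_underCells h) (hom_comp_eq hs) (hom_comp_eq ht)
      (hom_comp_eq hp) (hom_comp_eq hq) (hom_comp_eq hp') (hom_comp_eq hq'))

end ModComp

section Equipment

variable {C : Type u} [Category.{v} C] [VirtualDoubleCategory.{w, z} C]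

/-- Opcartesian cells: composition with `ω` induces bijections
`_f C_g(R, Q, S; T) ≅ _f C_g(R, P, S; T)`. -/
def IsOpcartesian {a b : C} {P : HPath (Pro (C := C)) a b} {Q : Pro a b}
    (ω : Cell (𝟙 a) (𝟙 b) P Q) : Prop :=
  ∀ ⦃a' b' x y : C⦄ (R : HPath (Pro (C := C)) a' a) (S : HPath (Pro (C := C)) b b')
    (f : a' ⟶ x) (g : b' ⟶ y) (T : Pro x y) (χ : Cell f g (R.append (P.append S)) T),
    ∃! ψ : Cell f g (R.append (.cons Q S)) T,
      comp ((CellPath.ids R).append (.cons ω (.ids S) rfl)) ψ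
        (Category.id_comp f) (Category.id_comp g) = χ

/-- Cartesian cells: composition with `κ` induces bijections
`_h C_k(R; P) ≅ _{fh} C_{gk}(R; Q)`. -/
def IsCartesian {a b a' b' : C} {f : a ⟶ a'} {g : b ⟶ b'} {P : Pro a b} {Q : Pro a' b'}
    (κ : Cell f g (.one P) Q) : Prop :=
  ∀ ⦃c d : C⦄ (h : c ⟶ a) (k : d ⟶ b) (R : HPath (Pro (C := C)) c d)
    (χ : Cell (h ≫ f) (k ≫ g) R Q), ∃! ψ : Cell h k R P, comp (.one ψ) κ rfl rfl = χ

/-- Invertible 2-cells. -/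
def IsIsoCell {a b a' b' : C} {f : a ⟶ a'} {g : b ⟶ b'} {P : Pro a b} {Q : Pro a' b'}
    (φ : Cell f g (.one P) Q) : Prop :=
  ∃ (f' : a' ⟶ a) (g' : b' ⟶ b) (ψ : Cell f' g' (.one Q) P) (hf : f ≫ f' = 𝟙 a)
    (hg : g ≫ g' = 𝟙 b) (hf' : f' ≫ f = 𝟙 a') (hg' : g' ≫ g = 𝟙 b'),
    comp (.one φ) ψ hf hg = idc P ∧ comp (.one ψ) φ hf' hg' = idc Q

/-- A unit of the object `c`. -/
structure UnitOf (c : C) where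
  pro : Pro c c
  cell : Cell (𝟙 c) (𝟙 c) (.nil c) pro
  opcartesian : IsOpcartesian cell

variable (C) in
/-- A choice of a unit of each object. -/
structure Units where
  unit : (c : C) → UnitOf c

variable (C) in
/-- A virtual equipment is a virtual double category that has units and restrictions. -/
structure IsVirtualEquipment : Prop where
  has_units : ∀ c : C, Nonempty (UnitOf c)
  has_restrictions : ∀ {a b a' b' : C} (f : a ⟶ a') (g : b ⟶ b') (Q : Pro a' b'),
    ∃ (P : Pro a b) (κ : Cell f g (.one P) Q), IsCartesian κ

theorem UnitOf.ext_left {c d : C} (η : UnitOf c) {S : HPath (Pro (C := C)) c d} {x y : C}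
    {f : c ⟶ x} {g : d ⟶ y} {T : Pro x y} {ψ ψ' : Cell f g (.cons η.pro S) T}
    (h : comp (P := S) (.cons η.cell (.ids S) rfl) ψ (Category.id_comp f) (Category.id_comp g) =
      comp (P := S) (.cons η.cell (.ids S) rfl) ψ' (Category.id_comp f) (Category.id_comp g)) :
    ψ = ψ' :=
  (η.opcartesian (.nil c) S f g T _).unique h rfl

theorem UnitOf.ext_right {c d : C} (η : UnitOf d) {R : HPath (Pro (C := C)) c d} {x y : C}
    {f : c ⟶ x} {g : d ⟶ y} {T : Pro x y} {ψ ψ' : Cell f g (R.append (.one η.pro)) T}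
    (h : comp ((CellPath.ids R).append (.cons η.cell (.nil _) rfl)) ψ
        (Category.id_comp f) (Category.id_comp g) =
      comp ((CellPath.ids R).append (.cons η.cell (.nil _) rfl)) ψ'
        (Category.id_comp f) (Category.id_comp g)) : ψ = ψ' :=
  (η.opcartesian R (.nil d) f g T _).unique h rfl

/-- The left action of a unit on a proarrow, determined by `unit_actL`. -/
noncomputable def UnitOf.actL {c d : C} (η : UnitOf c) (P : Pro c d) :
    Cell (𝟙 c) (𝟙 d) (.cons η.pro (.one P)) P :=
  (η.opcartesian (.nil c) (.one P) (𝟙 c) (𝟙 d) P (idc P)).choose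

theorem UnitOf.unit_actL {c d : C} (η : UnitOf c) (P : Pro c d) :
    comp (P := .one P) (.two η.cell (idc P) rfl) (η.actL P)
      (Category.id_comp _) (Category.id_comp _) = idc P :=
  (η.opcartesian (.nil c) (.one P) (𝟙 c) (𝟙 d) P (idc P)).choose_spec.1

/-- The right action of a unit on a proarrow, determined by `unit_actR`. -/
noncomputable def UnitOf.actR {c d : C} (η : UnitOf d) (P : Pro c d) :
    Cell (𝟙 c) (𝟙 d) (.cons P (.one η.pro)) P :=
  (η.opcartesian (.one P) (.nil d) (𝟙 c) (𝟙 d) P (idc P)).choose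

theorem UnitOf.unit_actR {c d : C} (η : UnitOf d) (P : Pro c d) :
    comp (P := .one P) (.two (idc P) η.cell rfl) (η.actR P)
      (Category.id_comp _) (Category.id_comp _) = idc P :=
  (η.opcartesian (.one P) (.nil d) (𝟙 c) (𝟙 d) P (idc P)).choose_spec.1

/-- Composing with a nullary cell on the left, and then acting by the unit. -/
theorem UnitOf.two_actL {c d a b : C} (η : UnitOf c) (P : Pro c d) {f : a ⟶ c} {g : b ⟶ d}
    {R : HPath (Pro (C := C)) a b} (φ : Cell f g R P) {χ : Cell f f (.nil a) η.pro}
    (hχ : comp (.nil f) η.cell (Category.comp_id f) (Category.comp_id f) = χ) :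
    comp (.two χ φ rfl) (η.actL P) (Category.comp_id f) (Category.comp_id g) = φ := by
  have h := assoc (η.actL P) (vcomp_two (IsAppend.nil f (.one φ)) (Category.comp_id f)
    (Category.comp_id f) (Category.comp_id g) hχ (comp_idc φ) (by rfl) (by rfl))
    (Category.id_comp _) (Category.id_comp _) (Category.comp_id f) (Category.comp_id g)
    (Category.comp_id f) (Category.comp_id g)
  exact h.symm.trans ((congrArg (fun t => comp _ t _ _) (η.unit_actL P)).trans (comp_idc φ))

theorem UnitOf.two_actR {c d a b : C} (η : UnitOf d) (P : Pro c d) {f : a ⟶ c} {g : b ⟶ d}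
    {R : HPath (Pro (C := C)) a b} (φ : Cell f g R P) {χ : Cell g g (.nil b) η.pro}
    (hχ : comp (.nil g) η.cell (Category.comp_id g) (Category.comp_id g) = χ) :
    comp (.two φ χ R.append_nil.symm) (η.actR P) (Category.comp_id f) (Category.comp_id g) = φ := by
  have h := assoc (η.actR P) (vcomp_two (isAppend_nil (.one φ)) (Category.comp_id f)
    (Category.comp_id g) (Category.comp_id g) (comp_idc φ) hχ (by rfl) R.append_nil.symm)
    (Category.id_comp _) (Category.id_comp _) (Category.comp_id f) (Category.comp_id g)
    (Category.comp_id f) (Category.comp_id g)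
  exact h.symm.trans ((congrArg (fun t => comp _ t _ _) (η.unit_actR P)).trans (comp_idc φ))

theorem UnitOf.nil_cell {c : C} (η : UnitOf c) :
    comp (.nil (𝟙 c)) η.cell (Category.comp_id _) (Category.comp_id _) = η.cell :=
  ids_comp η.cell

/-- A left action by a unit absorbs an inserted unit cell. -/
theorem UnitOf.insert_left {c d e : C} (η : UnitOf c) {S : HPath (Pro (C := C)) c d} {B : Pro c e}
    {g : d ⟶ e} (r : Cell (𝟙 c) g S B) :
    comp (P := S) (.cons η.cell (.ids S) rfl) (comp (P := .cons η.pro S) (.two (idc η.pro) r rfl)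
      (η.actL B) (Category.id_comp _) (Category.comp_id g)) (Category.id_comp _)
      (Category.id_comp _) = r := by
  refine (assoc (η.actL B) (vcomp_two (isAppend_one η.cell (.ids S) rfl) (Category.id_comp _)
    (Category.id_comp _) (Category.id_comp _) (comp_idc η.cell) (ids_comp r) rfl rfl) _ _ _ _
    (Category.id_comp _) (Category.comp_id _)).trans ?_
  exact η.two_actL B r η.nil_cell

theorem UnitOf.mul_one {c : C} (η : UnitOf c) :
    comp (P := .one η.pro) (.two (idc η.pro) η.cell rfl) (η.actL η.pro)
      (Category.id_comp _) (Category.id_comp _) = idc η.pro := by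
  apply η.ext_left
  refine (η.insert_left (S := .nil c) η.cell).trans ?_
  exact (comp_idc η.cell).symm

theorem UnitOf.actR_self {c : C} (η : UnitOf c) : η.actR η.pro = η.actL η.pro :=
  η.ext_right (R := .one η.pro) ((η.unit_actR η.pro).trans η.mul_one.symm)

/-- Inserting a unit cell at the left, next to an inner left action of the unit. -/
theorem UnitOf.insert_actL {c d e : C} (η : UnitOf c) (A : Pro c d) (A' : Pro d e) {B : Pro c e}
    (r : Cell (𝟙 c) (𝟙 e) (.cons A (.one A')) B) :
    comp (P := .cons A (.one A')) (.cons η.cell (.ids (.cons A (.one A'))) rfl)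
      (comp (P := .cons η.pro (.cons A (.one A'))) (.two (η.actL A) (idc A') rfl) r
        (Category.id_comp _) (Category.id_comp _)) (Category.id_comp _) (Category.id_comp _) =
      r := by
  refine (assoc r (vcomp_two (x₁ := .two η.cell (idc A) rfl) (x₂ := .one (idc A'))
    (.cons _ (isAppend_one _ _ _) _ _) (Category.id_comp _) (Category.id_comp _)
    (Category.id_comp _) (η.unit_actL A) (comp_idc (idc A')) rfl rfl) _ _ _ _
    (Category.id_comp _) (Category.id_comp _)).trans ?_
  exact ids_comp r

/-- The trivial monoid on an object, for a given unit. -/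
@[reducible]
noncomputable def UnitOf.trivialOn {c : C} (η : UnitOf c) : MonoidOn c where
  pro := η.pro
  one := η.cell
  mul := η.actL η.pro
  one_mul := η.unit_actL η.pro
  mul_one := η.mul_one
  mul_assoc := η.ext_left ((η.insert_actL _ _ _).trans (η.insert_left _).symm)

variable (U : Units C)

/-- The trivial monoid on an object. -/
@[reducible]
noncomputable def Units.trivial (x : C) : Mod C := ⟨x, (U.unit x).trivialOn⟩

/-- The unit 2-cell on a vertical arrow, determined by `unit_map`. -/
noncomputable def UnitOf.map {x y : C} (η : UnitOf x) (θ : UnitOf y) (k : x ⟶ y) :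
    Cell k k (.one η.pro) θ.pro :=
  (η.opcartesian (.nil x) (.nil x) k k θ.pro
    (comp (.nil k) θ.cell (Category.comp_id k) (Category.comp_id k))).choose

theorem UnitOf.unit_map {x y : C} (η : UnitOf x) (θ : UnitOf y) (k : x ⟶ y) :
    comp (.one η.cell) (η.map θ k) (Category.id_comp k) (Category.id_comp k) =
      comp (.nil k) θ.cell (Category.comp_id k) (Category.comp_id k) :=
  (η.opcartesian (.nil x) (.nil x) k k θ.pro
    (comp (.nil k) θ.cell (Category.comp_id k) (Category.comp_id k))).choose_spec.1

/-- The homomorphism of trivial monoids induced by a vertical arrow. -/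
@[reducible]
noncomputable def Units.trivialHom {x y : C} (k : x ⟶ y) : MonHom (U.trivial x) (U.trivial y) where
  hom := k
  cell := (U.unit x).map (U.unit y) k
  map_one := (U.unit x).unit_map (U.unit y) k
  map_mul := by
    apply (U.unit x).ext_left
    refine (assoc _ (vcomp_one _ _ (Category.id_comp _) (Category.id_comp _)) _ _ _ _
      (Category.id_comp k) (Category.id_comp k)).trans ?_
    refine .trans ?_ (assoc _ (vcomp_two (isAppend_one _ _ _) (Category.id_comp k)
      (Category.id_comp k) (Category.id_comp k) ((U.unit x).unit_map (U.unit y) k)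
      (ids_comp _) rfl rfl) _ _ _ _
      (Category.comp_id k) (Category.comp_id k)).symm
    refine .trans ?_ ((U.unit y).two_actL _ _ rfl).symm
    refine .trans ?_ (ids_comp _)
    exact congrArg (fun t => comp (.one t) _ _ _) ((U.unit x).unit_actL (U.unit x).pro)

/-- A proarrow, regarded as a bimodule between the trivial monoids on its ends. -/
@[reducible]
noncomputable def Units.trivialBimod {x y : C} (P : Pro x y) :
    Bimod (U.trivial x) (U.trivial y) where
  pro := P
  left := (U.unit x).actL P
  right := (U.unit y).actR P
  one_left := (U.unit x).unit_actL P
  mul_left := (U.unit x).ext_left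
    (((U.unit x).insert_actL _ _ _).trans ((U.unit x).insert_left _).symm)
  right_one := (U.unit y).unit_actR P
  right_mul := by
    refine (U.unit y).ext_right (R := .cons P (.one (U.unit y).pro)) ?_
    refine (assoc ((U.unit y).actR P) (vcomp_two (x₁ := .one (idc P))
      (x₂ := .two (idc (U.unit y).pro) (U.unit y).cell rfl)
      (isAppend_one _ _ _) (Category.id_comp _) (Category.id_comp _)
      (Category.id_comp _) (comp_idc (idc P)) (U.unit y).mul_one rfl rfl) _ _ _ _
      (Category.id_comp _) (Category.id_comp _)).trans ?_
    refine (ids_comp ((U.unit y).actR P)).trans (.symm ?_)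
    refine (assoc ((U.unit y).actR P) (vcomp_two (x₁ := .ids _)
      (x₂ := .one (U.unit y).cell)
      (isAppend_append (.ids (.cons P (.one (U.unit y).pro))) (.one (U.unit y).cell))
      (Category.id_comp _) (Category.id_comp _)
      (Category.id_comp _) (ids_comp ((U.unit y).actR P)) (comp_idc _) rfl rfl) _ _ _ _
      (Category.id_comp _) (Category.id_comp _)).trans ?_
    exact (U.unit y).two_actR P _ (U.unit y).nil_cell
  left_right := (U.unit x).ext_left
    (((U.unit x).insert_actL _ _ _).trans ((U.unit x).insert_left _).symm)

/-- A monoid, regarded as a bimodule over itself. -/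
@[reducible]
def Mod.unitBimod (M : Mod C) : Bimod M M where
  pro := M.pro
  left := M.mon.mul
  right := M.mon.mul
  one_left := M.mon.one_mul
  mul_left := M.mon.mul_assoc
  right_one := M.mon.mul_one
  right_mul := M.mon.mul_assoc.symm
  left_right := M.mon.mul_assoc

/-- Embeddings of a monoid `M` into an object `x`: homomorphisms to the trivial monoid on `x`. -/
abbrev Emb {c : C} (M : MonoidOn c) (x : C) := MonHom (⟨c, M⟩ : Mod C) (U.trivial x)

/-- Embeddings of a bimodule `B` into a proarrow `P` over given embeddings of its monoids. -/
abbrev BimodEmb {c d : C} {M : MonoidOn c} {N : MonoidOn d} {x y : C} (i : Emb U M x)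
    (j : Emb U N y) (B : Bimod (⟨c, M⟩ : Mod C) ⟨d, N⟩) (P : Pro x y) :=
  BimodHom i j (.one B) (U.trivialBimod P)

variable {U}

/-- The cell of an embedding of a monoid `M`, as an embedding of the unit `(M, M)`-bimodule. -/
@[reducible]
noncomputable def embToBimodEmb {c : C} {M : MonoidOn c} {x : C} (i : Emb U M x) :
    BimodEmb U i i (Mod.unitBimod ⟨c, M⟩) (U.unit x).pro where
  cell := i.cell
  left := i.map_mul
  right := i.map_mul.trans
    (congrArg (fun t => comp (.two i.cell i.cell rfl) t _ _) (U.unit x).actR_self.symm)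
  inner := by
    intro W p q h
    cases h with
    | there A h => cases h

/-- A collapse of the monoid `M` is a universal embedding: every embedding of `M` factors uniquely
through it. -/
def IsCollapse {c : C} {M : MonoidOn c} {x : C} (i : Emb U M x) : Prop :=
  ∀ ⦃y : C⦄ (j : Emb U M y), ∃! k : x ⟶ y, i.comp (U.trivialHom k) = j

/-- A collapse of a bimodule `B` over collapses `i`, `j` of its monoids is a universal embedding:
composition with it induces bijections from the 2-cells `P → Q` with frames `h`, `k` to the
embeddings of `B` into `Q` over `h ∘ i` and `k ∘ j`. -/
def IsBimodCollapse {c d : C} {M : MonoidOn c} {N : MonoidOn d} {x y : C} {i : Emb U M x}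
    {j : Emb U N y} {B : Bimod (⟨c, M⟩ : Mod C) ⟨d, N⟩} {P : Pro x y}
    (φ : BimodEmb U i j B P) : Prop :=
  IsCollapse i ∧ IsCollapse j ∧
    ∀ ⦃x' y' : C⦄ (h : x ⟶ x') (k : y ⟶ y') (Q : Pro x' y')
      (ψ : BimodEmb U (i.comp (U.trivialHom h)) (j.comp (U.trivialHom k)) B Q),
      ∃! χ : Cell h k (.one P) Q, comp (.one φ.cell) χ rfl rfl = ψ.cell

/-- A normal collapse of `M` is a collapse which also exhibits the unit of its target as the
bimodule collapse of the unit `(M, M)`-bimodule. -/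
def IsNormalCollapse {c : C} {M : MonoidOn c} {x : C} (i : Emb U M x) : Prop :=
  IsCollapse i ∧ IsBimodCollapse (embToBimodEmb i)

variable (U) in
/-- The monoid `M` has a normal collapse. -/
def HasNormalCollapse {c : C} (M : MonoidOn c) : Prop :=
  ∃ (x : C) (i : Emb U M x), IsNormalCollapse i

/-- An embedding exhibits `M` as the kernel of `f` if its underlying arrow is `f` and its cell is
cartesian, i.e. exhibits `M` as the restriction of the unit along `f` on both sides; the monoid
structure on such a restriction is determined by the cell being a homomorphism. -/
def IsKernel {c d : C} (f : c ⟶ d) {M : MonoidOn c} (i : Emb U M d) : Prop :=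
  i.hom = f ∧ IsCartesian i.cell

variable (U) in
/-- A monoid is effective if it is the kernel of some vertical arrow. -/
def IsEffective {c : C} (M : MonoidOn c) : Prop :=
  ∃ (d : C) (f : c ⟶ d) (i : Emb U M d), IsKernel f i

variable (U) in
/-- A regular cover is a vertical arrow which is a normal collapse of its kernel. -/
def IsRegularCover {c d : C} (f : c ⟶ d) : Prop :=
  ∃ (M : MonoidOn c) (i : Emb U M d), IsKernel f i ∧ IsNormalCollapse i

variable (C) in
/-- A virtual equipment is regular if every effective monoid has a normal collapse and every
cartesian embedding over the kernels of two regular covers is a bimodule collapse.  (Trivial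
monoids depend on a choice of units; we ask for the conditions for every choice.) -/
structure IsRegularVirtualEquipment : Prop where
  equipment : IsVirtualEquipment C
  effective_collapse : ∀ (U : Units C) {c : C} (M : MonoidOn c), IsEffective U M →
    HasNormalCollapse U M
  cartesian_collapse : ∀ (U : Units C) {c c' d d' : C} (f : c ⟶ d) (g : c' ⟶ d'),
    IsRegularCover U f → IsRegularCover U g →
    ∀ {M : MonoidOn c} {N : MonoidOn c'} {i : Emb U M d} {j : Emb U N d'},
    IsKernel f i → IsKernel g j →
    ∀ {A : Bimod (⟨c, M⟩ : Mod C) ⟨c', N⟩} {B : Pro d d'} (φ : BimodEmb U i j A B),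
    IsCartesian φ.cell → IsBimodCollapse φ

end Equipment

end VDC

/-! In $\mathrm{Mod}(\mathbb{D})$ the unit of an object $Y$ is $Y$ itself, regarded as a
$(Y,Y)$-bimodule. Everything rests on this. A monoid $(X,M)$ in $\mathrm{Mod}(\mathbb{D})$ is a
bimodule $M$ over the monoid $X$ with an associative product, so its underlying proarrow already
carries a monoid structure in $\mathbb{D}$, the total monoid (`MonoidOn.total`). The unit of $M$
induces a homomorphism from $X$ to it that is the identity on objects (`MonoidOn.unitHom`).

An embedding of $M$ into $Y$ is then the same thing as a monoid homomorphism from the total monoid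
to $Y$ (`embHom`). This correspondence is injective, natural in $Y$ and attains the identity of the
total monoid, so the total monoid represents the embeddings of $M$. Hence an embedding `i` is a
collapse exactly when `embHom i` is invertible (`IsCollapse.of_isIso`, `IsCollapse.isIso`), and
every monoid has a collapse. Likewise, an embedding of a bimodule $B$ into $Q$ is a homomorphism
into $Q$ from the total bimodule of $B$ (`bimodEmbHom`, `exists_bimodEmb`), and over collapses it is
a bimodule collapse exactly when its cell is invertible in $\mathbb{D}$. Applied to the unit
bimodule of $M$, this makes every collapse normal.

Restrictions in $\mathrm{Mod}(\mathbb{D})$ are computed in $\mathbb{D}$: a restricted proarrow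
inherits a unique structure that makes its cartesian cell a homomorphism, and such a cell is again
cartesian. Therefore, over homomorphisms whose underlying arrows are invertible, cartesian means
invertible in $\mathbb{D}$ (`BimodHom.isCartesian_iff_isIsoCell`). In particular, the kernel of such
an $F$ embeds into $Y$ by an invertible cell, and a homomorphism with an invertible cell is
invertible, so the embedding is a collapse. Conversely, a regular cover is the underlying vertical
arrow of a collapse, so its arrow in $\mathbb{D}$ is invertible. This is (b), and over regular
covers both conditions in (c) reduce to invertibility of the underlying cell.

The statement allows an arbitrary choice `U` of units in $\mathrm{Mod}(\mathbb{D})$. Embeddings are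
carried to the canonical units along the invertible comparison cells between units. -/

namespace VDC

open VirtualDoubleGraph VirtualDoubleStruct VirtualDoubleCategory

/-! ### Calculus of multi-composites -/

section General

variable {C : Type u} [Category.{v} C] [VirtualDoubleCategory.{w, z} C]

/-- Associativity of composition through a single middle cell. -/
theorem comp_one_comp {a b a' b' a'' b'' a₃ b₃ : C} {f : a ⟶ a'} {g : b ⟶ b'} {f' : a' ⟶ a''}
    {g' : b' ⟶ b''} {u : a ⟶ a''} {v : b ⟶ b''} {f'' : a'' ⟶ a₃} {g'' : b'' ⟶ b₃}
    {s : a' ⟶ a₃} {t : b' ⟶ b₃} {p : a ⟶ a₃} {q : b ⟶ b₃}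
    {P : HPath (Pro (C := C)) a b} {Q : HPath (Pro (C := C)) a' b'} {A : Pro a'' b''}
    {B : Pro a₃ b₃} (x : CellPath f g P Q) (φ : Cell f' g' Q A) (ψ : Cell f'' g'' (.one A) B)
    (hu : f ≫ f' = u) (hv : g ≫ g' = v) (hs : f' ≫ f'' = s) (ht : g' ≫ g'' = t)
    (hp : f ≫ s = p) (hq : g ≫ t = q) (hp' : u ≫ f'' = p) (hq' : v ≫ g'' = q) :
    comp (.one (comp x φ hu hv)) ψ hp' hq' = comp x (comp (.one φ) ψ hs ht) hp hq :=
  (assoc ψ (vcomp_one x φ hu hv) hs ht hp hq hp' hq').symm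

/-- Associativity of composition through two middle cells. -/
theorem comp_comp_two {a b c a' b' c' a'' b'' c'' a₃ c₃ : C} {f : a ⟶ a'} {g : b ⟶ b'}
    {h : c ⟶ c'} {f' : a' ⟶ a''} {g' : b' ⟶ b''} {h' : c' ⟶ c''} {f'' : a'' ⟶ a₃}
    {h'' : c'' ⟶ c₃} {s : a' ⟶ a₃} {t : c' ⟶ c₃} {p : a ⟶ a₃} {q : c ⟶ c₃}
    {u : a ⟶ a''} {v : b ⟶ b''} {w : c ⟶ c''}
    {P₁ : HPath (Pro (C := C)) a b} {Q₁ : HPath (Pro (C := C)) a' b'} {B : Pro a'' b''}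
    {P₂ : HPath (Pro (C := C)) b c} {Q₂ : HPath (Pro (C := C)) b' c'} {B' : Pro b'' c''}
    {P : HPath (Pro (C := C)) a c} {Q : HPath (Pro (C := C)) a' c'} {E : Pro a₃ c₃}
    {x₁ : CellPath f g P₁ Q₁} {x₂ : CellPath g h P₂ Q₂} {x : CellPath f h P Q}
    {φ : Cell f' g' Q₁ B} {ψ : Cell g' h' Q₂ B'} {χ : Cell u v P₁ B} {ω : Cell v w P₂ B'}
    (θ : Cell f'' h'' (.cons B (.one B')) E) (hx : IsAppend x₁ x₂ x)
    (hu : f ≫ f' = u) (hv : g ≫ g' = v) (hw : h ≫ h' = w)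
    (hχ : comp x₁ φ hu hv = χ) (hω : comp x₂ ψ hv hw = ω)
    (hQ : Q = Q₁.append Q₂) (hP : P = P₁.append P₂)
    (hs : f' ≫ f'' = s) (ht : h' ≫ h'' = t) (hp : f ≫ s = p) (hq : h ≫ t = q)
    (hp' : u ≫ f'' = p) (hq' : w ≫ h'' = q) :
    comp x (comp (.two φ ψ hQ) θ hs ht) hp hq = comp (.two χ ω hP) θ hp' hq' :=
  assoc θ (vcomp_two hx hu hv hw hχ hω hQ hP) hs ht hp hq hp' hq'

/-- Nesting two commuting squares of cells, the inner one on the left. -/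
theorem nest_left {c₀ c₁ c₂ d₀ d₁ d₂ : C} {f : c₀ ⟶ d₀} {g : c₁ ⟶ d₁} {h : c₂ ⟶ d₂}
    {R : HPath (Pro (C := C)) c₀ c₁} {R' : HPath (Pro (C := C)) d₀ d₁}
    {A : Pro c₀ c₁} {A' : Pro d₀ d₁} {B : Pro c₁ c₂} {B' : Pro d₁ d₂} {E : Pro c₀ c₂}
    {E' : Pro d₀ d₂} {W : HPath (Pro (C := C)) c₀ c₂} {W' : HPath (Pro (C := C)) d₀ d₂}
    {α : Cell (𝟙 _) (𝟙 _) R A} {α' : Cell (𝟙 _) (𝟙 _) R' A'} {x : CellPath f g R R'}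
    {a : Cell f g (.one A) A'} {b : Cell g h (.one B) B'}
    {β : Cell (𝟙 _) (𝟙 _) (.cons A (.one B)) E} {β' : Cell (𝟙 _) (𝟙 _) (.cons A' (.one B')) E'}
    {e : Cell f h (.one E) E'} {y : CellPath f h W W'}
    (hα : comp (.one α) a (Category.id_comp _) (Category.id_comp _) =
      comp x α' (Category.comp_id _) (Category.comp_id _))
    (hβ : comp (.one β) e (Category.id_comp _) (Category.id_comp _) =
      comp (P := .cons A (.one B)) (.two a b rfl) β' (Category.comp_id _) (Category.comp_id _))
    (hy : IsAppend x (.one b) y) (hW : W = R.append (.one B)) (hW' : W' = R'.append (.one B')) :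
    comp (.one (comp (.two α (idc B) hW) β (Category.id_comp _) (Category.id_comp _))) e
        (Category.id_comp _) (Category.id_comp _) =
      comp y (comp (.two α' (idc B') hW') β' (Category.id_comp _) (Category.id_comp _))
        (Category.comp_id _) (Category.comp_id _) := by
  refine (comp_one_comp _ β e _ _ (Category.id_comp _) (Category.id_comp _)
    (Category.id_comp _) (Category.id_comp _) _ _).trans ?_
  rw [hβ]
  refine (comp_comp_two β' (isAppend_one α (.one (idc B)) hW) (Category.id_comp _)
    (Category.id_comp _) (Category.id_comp _) hα (ids_comp b) rfl hW _ _ _ _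
    (Category.comp_id _) (Category.comp_id _)).trans ?_
  exact (comp_comp_two β' hy (Category.comp_id _) (Category.comp_id _) (Category.comp_id _)
    rfl (comp_idc b) hW' hW _ _ _ _ _ _).symm

/-- Nesting two commuting squares of cells, the inner one on the right. -/
theorem nest_right {c₀ c₁ c₂ d₀ d₁ d₂ : C} {f : c₀ ⟶ d₀} {g : c₁ ⟶ d₁} {h : c₂ ⟶ d₂}
    {R : HPath (Pro (C := C)) c₁ c₂} {R' : HPath (Pro (C := C)) d₁ d₂}
    {A : Pro c₀ c₁} {A' : Pro d₀ d₁} {B : Pro c₁ c₂} {B' : Pro d₁ d₂} {E : Pro c₀ c₂}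
    {E' : Pro d₀ d₂} {W : HPath (Pro (C := C)) c₀ c₂} {W' : HPath (Pro (C := C)) d₀ d₂}
    {α : Cell (𝟙 _) (𝟙 _) R B} {α' : Cell (𝟙 _) (𝟙 _) R' B'} {x : CellPath g h R R'}
    {a : Cell f g (.one A) A'} {b : Cell g h (.one B) B'}
    {β : Cell (𝟙 _) (𝟙 _) (.cons A (.one B)) E} {β' : Cell (𝟙 _) (𝟙 _) (.cons A' (.one B')) E'}
    {e : Cell f h (.one E) E'} {y : CellPath f h W W'}
    (hα : comp (.one α) b (Category.id_comp _) (Category.id_comp _) =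
      comp x α' (Category.comp_id _) (Category.comp_id _))
    (hβ : comp (.one β) e (Category.id_comp _) (Category.id_comp _) =
      comp (P := .cons A (.one B)) (.two a b rfl) β' (Category.comp_id _) (Category.comp_id _))
    (hy : IsAppend (.one a) x y) (hW : W = (HPath.one A).append R)
    (hW' : W' = (HPath.one A').append R') :
    comp (.one (comp (.two (idc A) α hW) β (Category.id_comp _) (Category.id_comp _))) e
        (Category.id_comp _) (Category.id_comp _) =
      comp y (comp (.two (idc A') α' hW') β' (Category.id_comp _) (Category.id_comp _))
        (Category.comp_id _) (Category.comp_id _) := by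
  refine (comp_one_comp _ β e _ _ (Category.id_comp _) (Category.id_comp _)
    (Category.id_comp _) (Category.id_comp _) _ _).trans ?_
  rw [hβ]
  refine (comp_comp_two β' (isAppend_one (idc A) (.one α) hW) (Category.id_comp _)
    (Category.id_comp _) (Category.id_comp _) (ids_comp a) hα rfl hW _ _ _ _
    (Category.comp_id _) (Category.comp_id _)).trans ?_
  exact (comp_comp_two β' hy (Category.comp_id _) (Category.comp_id _) (Category.comp_id _)
    (comp_idc a) rfl hW' hW _ _ _ _ _ _).symm

/-! ### Cartesian and invertible cells -/

section Cartesian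

variable {a b a' b' : C} {f : a ⟶ a'} {g : b ⟶ b'} {P : Pro a b} {Q : Pro a' b'}
  {κ : Cell f g (.one P) Q}

/-- The universal property for frames that equal the composites only provably. Frames arising from
identities or inverses are never syntactically of the form `h ≫ f`. -/
theorem IsCartesian.existsUnique (hκ : IsCartesian κ) {c d : C} {h : c ⟶ a} {k : d ⟶ b}
    {u : c ⟶ a'} {v : d ⟶ b'} (hu : h ≫ f = u) (hv : k ≫ g = v)
    {R : HPath (Pro (C := C)) c d} (χ : Cell u v R Q) :
    ∃! ψ : Cell h k R P, comp (.one ψ) κ hu hv = χ := by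
  subst hu hv
  exact hκ h k R χ

theorem IsCartesian.hom_ext (hκ : IsCartesian κ) {c d : C} {h : c ⟶ a} {k : d ⟶ b}
    {u : c ⟶ a'} {v : d ⟶ b'} (hu : h ≫ f = u) (hv : k ≫ g = v)
    {R : HPath (Pro (C := C)) c d} {ψ ψ' : Cell h k R P}
    (e : comp (.one ψ) κ hu hv = comp (.one ψ') κ hu hv) : ψ = ψ' :=
  (hκ.existsUnique hu hv _).unique e rfl

/-- Composition with the inverse cell is the inverse of the bijection. -/
theorem IsIsoCell.isCartesian (hκ : IsIsoCell κ) : IsCartesian κ := by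
  obtain ⟨f', g', κ', hf, hg, hf', hg', h₁, h₂⟩ := hκ
  intro c d h k R χ
  refine ⟨comp (.one χ) κ' (by rw [Category.assoc, hf, Category.comp_id])
    (by rw [Category.assoc, hg, Category.comp_id]), ?_, ?_⟩
  · refine (comp_one_comp _ _ _ _ _ hf' hg' (Category.comp_id _) (Category.comp_id _) _ _).trans ?_
    rw [h₂, comp_idc]
  · rintro ψ rfl
    refine .symm ((comp_one_comp _ _ _ _ _ hf hg (Category.comp_id _) (Category.comp_id _)
      _ _).trans ?_)
    rw [h₁, comp_idc]

/-- The inverse is the lift of the identity of `Q` along the inverse frames. It is a one-sided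
inverse by construction, and the other equation may be tested after composing with `κ`. -/
theorem IsCartesian.isIsoCell [IsIso f] [IsIso g] (hκ : IsCartesian κ) : IsIsoCell κ := by
  obtain ⟨ψ, hψ, -⟩ := hκ.existsUnique (IsIso.inv_hom_id f) (IsIso.inv_hom_id g) (idc Q)
  refine ⟨inv f, inv g, ψ, by simp, by simp, by simp, by simp, ?_, hψ⟩
  apply hκ.hom_ext (Category.id_comp f) (Category.id_comp g)
  refine (comp_one_comp _ _ _ _ _ (IsIso.inv_hom_id f) (IsIso.inv_hom_id g)
    (Category.comp_id _) (Category.comp_id _) _ _).trans ?_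
  rw [hψ, comp_idc]
  exact (ids_comp κ).symm

theorem IsIsoCell.comp {a'' b'' : C} {f' : a' ⟶ a''} {g' : b' ⟶ b''} {u : a ⟶ a''} {v : b ⟶ b''}
    {R : Pro a'' b''} {ψ : Cell f' g' (.one Q) R} (hκ : IsIsoCell κ) (hψ : IsIsoCell ψ)
    (hu : f ≫ f' = u) (hv : g ≫ g' = v) : IsIsoCell (comp (.one κ) ψ hu hv) := by
  obtain ⟨p, q, κ', hp, hq, hp', hq', h₁, h₂⟩ := hκ
  obtain ⟨s, t, ψ', hs, ht, hs', ht', h₃, h₄⟩ := hψ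
  subst hu hv
  have e₁ : f' ≫ s ≫ p = p := by rw [← Category.assoc, hs, Category.id_comp]
  have e₂ : g' ≫ t ≫ q = q := by rw [← Category.assoc, ht, Category.id_comp]
  have e₃ : p ≫ f ≫ f' = f' := by rw [← Category.assoc, hp', Category.id_comp]
  have e₄ : q ≫ g ≫ g' = g' := by rw [← Category.assoc, hq', Category.id_comp]
  refine ⟨s ≫ p, t ≫ q, VirtualDoubleStruct.comp (.one ψ') κ' rfl rfl, by simp [e₁, hp],
    by simp [e₂, hq], by simp [e₃, hs'], by simp [e₄, ht'], ?_, ?_⟩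
  · refine (comp_one_comp _ _ _ _ _ e₁ e₂ hp hq _ _).trans ?_
    rw [← comp_one_comp (.one ψ) ψ' κ' hs ht _ _ _ _ (Category.id_comp _) (Category.id_comp _),
      h₃]
    exact (congrArg (fun t => VirtualDoubleStruct.comp _ t _ _) (ids_comp κ')).trans h₁
  · refine (comp_one_comp _ _ _ _ _ e₃ e₄ hs' ht' _ _).trans ?_
    rw [← comp_one_comp (.one κ') κ ψ hp' hq' _ _ _ _ (Category.id_comp _) (Category.id_comp _),
      h₂]
    exact (congrArg (fun t => VirtualDoubleStruct.comp _ t _ _) (ids_comp ψ)).trans h₄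

/-- Two cartesian cells over the same frames differ by an invertible cell. -/
theorem IsCartesian.exists_iso (hκ : IsCartesian κ) {P' : Pro a b} {κ' : Cell f g (.one P') Q}
    (hκ' : IsCartesian κ') : ∃ θ : Cell (𝟙 a) (𝟙 b) (.one P') P, IsIsoCell θ ∧
      comp (.one θ) κ (Category.id_comp f) (Category.id_comp g) = κ' := by
  obtain ⟨θ, hθ, -⟩ := hκ.existsUnique (Category.id_comp f) (Category.id_comp g) κ'
  obtain ⟨θ', hθ', -⟩ := hκ'.existsUnique (Category.id_comp f) (Category.id_comp g) κ
  refine ⟨θ, ⟨𝟙 a, 𝟙 b, θ', by simp, by simp, by simp, by simp, ?_, ?_⟩, hθ⟩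
  · apply hκ'.hom_ext (Category.id_comp f) (Category.id_comp g)
    refine (comp_one_comp _ _ _ _ _ (Category.id_comp f) (Category.id_comp g)
      (Category.id_comp _) (Category.id_comp _) _ _).trans ?_
    rw [hθ', hθ]
    exact (ids_comp κ').symm
  · apply hκ.hom_ext (Category.id_comp f) (Category.id_comp g)
    refine (comp_one_comp _ _ _ _ _ (Category.id_comp f) (Category.id_comp g)
      (Category.id_comp _) (Category.id_comp _) _ _).trans ?_
    rw [hθ, hθ']
    exact (ids_comp κ).symm

end Cartesian

/-- The restriction of a monoid along a vertical arrow is a monoid, and the cartesian cell is a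
homomorphism. -/
theorem MonoidOn.exists_restrict {c d : C} (N : MonoidOn d) {f : c ⟶ d} {P : Pro c c}
    {κ : Cell f f (.one P) N.pro} (hκ : IsCartesian κ) :
    ∃ (M : MonoidOn c) (F : MonHom (⟨c, M⟩ : Mod C) ⟨d, N⟩), F.hom = f ∧ IsCartesian F.cell := by
  -- The unit and the multiplication are forced: they are the lifts through `κ` of exactly the cells
  -- that make `κ` a homomorphism.
  obtain ⟨e, he, -⟩ := hκ.existsUnique (Category.id_comp f) (Category.id_comp f)
    (comp (.nil f) N.one (Category.comp_id f) (Category.comp_id f))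
  obtain ⟨m, hm, -⟩ := hκ.existsUnique (Category.id_comp f) (Category.id_comp f)
    (comp (P := .cons P (.one P)) (.two κ κ rfl) N.mul (Category.comp_id f) (Category.comp_id f))
  refine ⟨⟨P, e, m, ?_, ?_, ?_⟩, ⟨f, κ, he, hm⟩, rfl, hκ⟩
  -- Each axiom compares two cells into `P`, so it may be checked after composing with `κ`. There
  -- the nesting lemmas turn it into the same axiom for `N`.
  · apply hκ.hom_ext (Category.id_comp f) (Category.id_comp f)
    refine (nest_left he hm (y := .one κ) (.nil _ _) _ rfl).trans ?_
    rw [N.one_mul, comp_idc]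
    exact (ids_comp κ).symm
  · apply hκ.hom_ext (Category.id_comp f) (Category.id_comp f)
    refine (nest_right he hm (y := .one κ) (isAppend_nil _) _ rfl).trans ?_
    rw [N.mul_one, comp_idc]
    exact (ids_comp κ).symm
  · apply hκ.hom_ext (Category.id_comp f) (Category.id_comp f)
    refine (nest_left hm hm (y := .cons κ (.two κ κ rfl) rfl)
      (.cons _ (isAppend_one _ _ _) _ _) _ rfl).trans ?_
    rw [N.mul_assoc]
    exact (nest_right hm hm (isAppend_one _ _ _) _ rfl).symm

theorem UnitOf.hom_ext {x : C} (η : UnitOf x) {y z : C} {f : x ⟶ y} {g : x ⟶ z} {T : Pro y z}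
    {ψ ψ' : Cell f g (.one η.pro) T}
    (h : comp (.one η.cell) ψ (Category.id_comp f) (Category.id_comp g) =
      comp (.one η.cell) ψ' (Category.id_comp f) (Category.id_comp g)) : ψ = ψ' :=
  η.ext_left (S := .nil x) h

theorem UnitOf.map_id {x : C} (η : UnitOf x) : η.map η (𝟙 x) = idc η.pro :=
  η.hom_ext (((η.unit_map η (𝟙 x)).trans η.nil_cell).trans (comp_idc η.cell).symm)

/-- A cell out of a unit is determined by its composite with the nullary unit cell. Here both sides
give the unit cell of `ζ` with frames `m`. -/
theorem UnitOf.map_comp {x y t : C} (η : UnitOf x) (θ : UnitOf y) (ζ : UnitOf t) (k : x ⟶ y)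
    (l : y ⟶ t) {m : x ⟶ t} (h : k ≫ l = m) :
    comp (.one (η.map θ k)) (θ.map ζ l) h h = η.map ζ m := by
  apply η.hom_ext
  rw [η.unit_map]
  refine (assoc _ (vcomp_one (.one η.cell) (η.map θ k) (Category.id_comp _) (Category.id_comp _))
    h h _ _ h h).trans ?_
  rw [η.unit_map]
  refine (comp_one_comp (.nil k) θ.cell (θ.map ζ l) _ _ (Category.id_comp _) (Category.id_comp _)
    h h _ _).trans ?_
  rw [θ.unit_map]
  exact assoc _ (.nil h) _ _ _ _ _ _

end General

/-! ### Units in the virtual double category of monoids -/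

section ModUnits

variable {C : Type u} [Category.{v} C] [VirtualDoubleCategory.{w, z} C]

theorem innerCompat_one {M N : Mod C} {A : Bimod M N} {a b : C} {f : M.obj ⟶ a}
    {g : N.obj ⟶ b} {B : Pro a b} (φ : Cell f g (under (.one A)) B) :
    InnerCompat (.one A) φ := by
  intro W x y h
  cases h with
  | there A h => cases h

/-- A string of two bimodules has a single inner monoid, so the condition is a single equation. -/
theorem innerCompat_two {M L N : Mod C} {A : Bimod M L} {A' : Bimod L N} {a b : C}
    {f : M.obj ⟶ a} {g : N.obj ⟶ b} {B : Pro a b}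
    {φ : Cell f g (under (.cons A (.one A'))) B}
    (hφ : comp (P := .cons A.pro (.cons L.pro (.one A'.pro))) (.two A.right (idc A'.pro) rfl) φ
        (Category.id_comp f) (Category.id_comp g) =
      comp (P := .cons A.pro (.cons L.pro (.one A'.pro))) (.two (idc A.pro) A'.left rfl) φ
        (Category.id_comp f) (Category.id_comp g)) :
    InnerCompat (.cons A (.one A')) φ := by
  intro W x y h
  cases h with
  | here => exact hφ
  | there A h =>
    cases h with
    | there A h => cases h

/-- The left action of a bimodule, as a bimodule homomorphism. -/
def Bimod.leftHom {M N : Mod C} (A : Bimod M N) :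
    BimodHom (𝟙 M) (𝟙 N) (.cons M.unitBimod (.one A)) A where
  cell := A.left
  left := A.mul_left
  right := A.left_right.symm
  inner := innerCompat_two A.mul_left

/-- The right action of a bimodule, as a bimodule homomorphism. -/
def Bimod.rightHom {M N : Mod C} (A : Bimod M N) :
    BimodHom (𝟙 M) (𝟙 N) (.cons A (.one N.unitBimod)) A where
  cell := A.right
  left := A.left_right
  right := A.right_mul
  inner := innerCompat_two A.right_mul.symm

/-- The unit of a monoid, as a bimodule homomorphism. -/
def Mod.oneHom (M : Mod C) : BimodHom (𝟙 M) (𝟙 M) (.nil M) M.unitBimod where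
  cell := M.mon.one
  left := M.mon.mul_one.trans M.mon.one_mul.symm
  right := trivial
  inner := by
    intro W x y h
    cases h

theorem Bimod.one_leftHom {M N : Mod C} (A : Bimod M N) :
    comp (C := Mod C) (P := .one A) (.two (C := Mod C) M.oneHom (BimodHom.id A) rfl) A.leftHom
      (Category.id_comp _) (Category.id_comp _) = BimodHom.id A :=
  BimodHom.ext A.one_left

theorem Bimod.rightHom_one {M N : Mod C} (A : Bimod M N) :
    comp (C := Mod C) (P := .one A) (.two (C := Mod C) (BimodHom.id A) N.oneHom rfl) A.rightHom
      (Category.id_comp _) (Category.id_comp _) = BimodHom.id A :=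
  BimodHom.ext A.right_one

/-- Absorbing the unit bimodule of an inner monoid into the preceding bimodule. -/
def absorb {L : Mod C} : {M K N : Mod C} → (A : Bimod M K) → (R : HPath (Bimod (C := C)) K L) →
    (S : HPath (Bimod (C := C)) L N) → CellPath (C := Mod C) (𝟙 M) (𝟙 N)
      ((HPath.cons A R).append (.cons L.unitBimod S)) ((HPath.cons A R).append S)
  | _, _, _, A, .nil _, S => .cons (C := Mod C) A.rightHom (.ids (C := Mod C) S) rfl
  | _, _, _, A, .cons A' R, S => .cons (C := Mod C) (BimodHom.id A) (absorb A' R S) rfl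

/-- Inserting the unit of a monoid into a string of bimodules. -/
abbrev insertUnit {M L N : Mod C} (R : HPath (Bimod (C := C)) M L)
    (S : HPath (Bimod (C := C)) L N) :
    CellPath (C := Mod C) (𝟙 M) (𝟙 N) (R.append S) (R.append (.cons L.unitBimod S)) :=
  (CellPath.ids (C := Mod C) R).append (.cons (C := Mod C) L.oneHom (.ids (C := Mod C) S) rfl)

/-- The right unit law of the bimodule just before the inserted unit. This is the strict half of the
statement that absorbing is inverse to inserting. -/
theorem vcomp_insertUnit_absorb {M K L N : Mod C} (A : Bimod M K)
    (R : HPath (Bimod (C := C)) K L) (S : HPath (Bimod (C := C)) L N) :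
    VComp (insertUnit (.cons A R) S) (absorb A R S)
      (CellPath.ids (C := Mod C) ((HPath.cons A R).append S)) := by
  induction R generalizing M with
  | nil L =>
    refine .cons' (x₁ := .two (idc (C := Mod C) A) L.oneHom rfl)
      (.cons _ (isAppend_one _ _ _) _ _) (Category.id_comp _) (Category.id_comp _)
      A.rightHom_one (ids_vcomp _) _ _
  | cons A' R ih =>
    exact .cons' (isAppend_one _ _ _) (Category.id_comp _) (Category.id_comp _)
      (comp_idc (C := Mod C) (idc (C := Mod C) A)) (ih A' S) _ _

/-- The other half holds only up to one move of an inner monoid, not as an equality of strings. This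
is enough, because a bimodule homomorphism does not distinguish strings related by moves. -/
theorem exists_move_absorb {M K L N : Mod C} (A : Bimod M K)
    (R : HPath (Bimod (C := C)) K L) (S : HPath (Bimod (C := C)) L N) :
    ∃ x, VComp (absorb A R S) (insertUnit (.cons A R) S) x ∧
      Move ((HPath.cons A R).append (.cons L.unitBimod S)) (underCells x)
        (underCells (CellPath.ids (C := Mod C) _)) := by
  induction R generalizing M with
  | nil L =>
    refine ⟨.cons (C := Mod C) A.rightHom (.cons (C := Mod C) L.oneHom
      (.ids (C := Mod C) S) rfl) rfl, ?_, ?_⟩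
    · refine .cons' (isAppend_one _ _ _) (Category.comp_id _) (Category.comp_id _)
        (comp_idc (C := Mod C) A.rightHom) ?_ _ _
      exact .cons' (.nil _ _) (Category.comp_id _) (Category.comp_id _)
        (ids_comp (C := Mod C) L.oneHom) (vcomp_ids _) _ _
    -- The copy of `L` absorbed by `A` is moved to the right onto the freshly inserted unit, where
    -- `mul_one` turns the product into the identity.
    · have h := Move.here A L.unitBimod S (idc A.pro) (idc L.pro) L.mon.one
        (CellPath.ids (under S)) (RS := .cons A.pro (.one L.pro)) rfl rfl (ST := .one L.pro) rfl
        rfl rfl rfl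
      rw [show comp (.two (idc A.pro) (idc L.pro) _) A.right _ _ = A.right from ids_comp A.right,
        show comp (P := .one L.pro) (.two (idc L.pro) L.mon.one _) L.mon.mul _ _ = idc L.pro from
          L.mon.mul_one, ← underCells_ids S] at h
      exact h
  | cons A' R ih =>
    obtain ⟨x, hx, hm⟩ := ih A' S
    refine ⟨.cons (C := Mod C) (BimodHom.id A) x rfl, ?_, .there A _ hm _⟩
    exact .cons' (isAppend_one _ _ _) (Category.comp_id _) (Category.comp_id _)
      (comp_idc (C := Mod C) (idc (C := Mod C) A)) hx _ _

/-- Multiplicativity of `F` followed by associativity of the left action of `T`. Both compatibility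
conditions of `BimodHom.extend` begin with this equation. -/
theorem mul_comp_two_left {M N K : Mod C} (F : MonHom M N) {T : Bimod N K} {b : C}
    {g : b ⟶ K.obj} {R : HPath (Pro (C := C)) M.obj b} (χ : Cell F.hom g R T.pro) :
    comp (P := .cons M.pro (.cons M.pro R)) (.cons M.mon.mul (.ids R) rfl)
        (comp (P := .cons M.pro R) (.two F.cell χ rfl) T.left (Category.comp_id _)
          (Category.comp_id _)) (Category.id_comp _) (Category.id_comp _) =
      comp (P := .cons M.pro (.cons M.pro R)) (.two F.cell (comp (P := .cons M.pro R)
        (.two F.cell χ rfl) T.left (Category.comp_id _) (Category.comp_id _)) rfl) T.left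
        (Category.comp_id _) (Category.comp_id _) := by
  refine (comp_comp_two T.left (isAppend_one _ _ _) (Category.id_comp _) (Category.id_comp _)
    (Category.id_comp _) F.map_mul (ids_comp χ) _ rfl _ _ _ _ (Category.comp_id _)
    (Category.comp_id _)).trans ?_
  refine (comp_comp_two (x := .cons F.cell (.two F.cell χ rfl) rfl) T.left
    (.cons _ (isAppend_one _ _ _) _ _) (Category.comp_id _) (Category.comp_id _)
    (Category.comp_id _) rfl (comp_idc χ) rfl _ (Category.id_comp _) (Category.id_comp _)
    (Category.comp_id _) (Category.comp_id _) _ _).symm.trans ?_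
  rw [T.mul_left]
  exact comp_comp_two T.left (isAppend_one _ _ _) (Category.comp_id _) (Category.comp_id _)
    (Category.comp_id _) (comp_idc _) rfl rfl _ _ _ _ _ _ _

/-- The extension of a nullary homomorphism along the unit of its monoid. -/
def BimodHom.extend {M X Y : Mod C} {F : MonHom M X} {G : MonHom M Y} {T : Bimod X Y}
    (χ : BimodHom F G (.nil M) T) : BimodHom F G (.one M.unitBimod) T where
  cell := VirtualDoubleStruct.comp (P := .one M.pro) (.two F.cell χ.cell rfl) T.left
    (Category.comp_id _) (Category.comp_id _)
  left := mul_comp_two_left F χ.cell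
  right := by
    refine (mul_comp_two_left F χ.cell).trans ?_
    -- For a nullary cell, left compatibility says that the left and right actions on it agree. So
    -- the extension, built from the left action, can also be written with the right action.
    have hχ := χ.left
    simp only [LeftCompat] at hχ
    refine .trans ?_ (comp_comp_two (x := .cons F.cell (.two χ.cell G.cell rfl) rfl) T.right
      (.cons _ (isAppend_one _ _ _) _ _) (Category.comp_id _) (Category.comp_id _)
      (Category.comp_id _) rfl (comp_idc G.cell) rfl _ (Category.id_comp _) (Category.id_comp _)
      (Category.comp_id _) (Category.comp_id _) _ _)
    rw [T.left_right]
    exact (comp_comp_two T.left (isAppend_one _ _ _) (Category.comp_id _) (Category.comp_id _)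
      (Category.comp_id _) (comp_idc _) hχ.symm rfl _ _ _ _ _ _ _).symm
  inner := innerCompat_one _

/-- Since `F` preserves units, the unit of `M` acts on the cell through the unit of `X`, and hence
trivially. -/
theorem BimodHom.one_extend {M X Y : Mod C} {F : M ⟶ X} {G : M ⟶ Y} {T : Bimod X Y}
    (χ : BimodHom F G (.nil M) T) :
    VirtualDoubleStruct.comp (C := Mod C) (.one (C := Mod C) M.oneHom) χ.extend
      (Category.id_comp F) (Category.id_comp G) = χ := by
  refine BimodHom.ext ?_
  refine (comp_comp_two T.left (isAppend_one M.mon.one (.nil (𝟙 M.obj)) rfl)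
    (Category.id_comp _) (Category.id_comp _) (Category.id_comp _) (MonHom.map_one F)
    (ids_comp χ.cell) rfl rfl _ _ _ _ (Category.comp_id _)
    (Category.comp_id _)).trans ?_
  refine (comp_comp_two (x := .one χ.cell) T.left (.nil _ _)
    (Category.comp_id _) (Category.comp_id _) (Category.comp_id _) rfl
    (comp_idc χ.cell) rfl _ (Category.id_comp _) (Category.id_comp _)
    (Category.comp_id _) (Category.comp_id _) _ _).symm.trans ?_
  rw [T.one_left]
  exact comp_idc _

/-- If some bimodule stands next to the inserted unit bimodule, its action absorbs the latter, and
composition with this absorption inverts composition with the insertion. If the surrounding strings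
are both empty, the target has to provide the action instead. -/
theorem opcartesian_oneHom (M : Mod C) : IsOpcartesian (C := Mod C) M.oneHom := by
  intro K N X Y R S F G T χ
  -- It suffices to give a string `V` that undoes the insertion strictly on one side and up to moves
  -- on the other. The required cell is then `V` followed by `χ`.
  have key : ∀ {V : CellPath (C := Mod C) (𝟙 K) (𝟙 N) (R.append (.cons M.unitBimod S))
      (R.append S)} (_ : VComp (insertUnit R S) V (CellPath.ids (C := Mod C) (R.append S)))
      {x : CellPath (C := Mod C) (𝟙 K) (𝟙 N) (R.append (.cons M.unitBimod S))
        (R.append (.cons M.unitBimod S))} (_ : VComp V (insertUnit R S) x)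
      (_ : Moves (R.append (.cons M.unitBimod S)) (underCells x)
        (underCells (CellPath.ids (C := Mod C) _))),
      ∃! ψ : Cell (C := Mod C) F G (R.append (.cons M.unitBimod S)) T,
        comp (insertUnit R S) ψ (Category.id_comp F) (Category.id_comp G) = χ := by
    intro V h₁ x h₂ h₃
    refine ⟨comp V χ (Category.id_comp F) (Category.id_comp G), ?_, ?_⟩
    · exact (assoc χ h₁ _ _ _ _ (Category.id_comp F) (Category.id_comp G)).trans (ids_comp χ)
    · rintro ψ rfl
      refine .symm ((assoc ψ h₂ _ _ _ _ (Category.id_comp F) (Category.id_comp G)).trans ?_)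
      refine .trans ?_ (ids_comp ψ)
      exact BimodHom.ext (h₃.comp_eq (BimodHom.inner ψ) _ _)
  cases R with
  | cons A R =>
    obtain ⟨x, hx, hm⟩ := exists_move_absorb A R S
    exact key (vcomp_insertUnit_absorb A R S) hx (.rel _ _ hm)
  | nil =>
    cases S with
    | cons A S =>
      -- With nothing on the left, the unit bimodule is absorbed by the left action of its right
      -- neighbour. The move now starts from the identity string, which is why it is used in the
      -- reverse direction.
      refine key (V := .cons (C := Mod C) A.leftHom (.ids (C := Mod C) S) rfl)
        (x := .cons (C := Mod C) M.oneHom (.cons (C := Mod C) A.leftHom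
          (.ids (C := Mod C) S) rfl) rfl) ?_ ?_ (.symm _ _ (.rel _ _ ?_))
      · exact .cons' (x₁ := .two M.oneHom (idc (C := Mod C) A) rfl)
          (.cons _ (isAppend_one _ _ _) _ _) (Category.id_comp _) (Category.id_comp _)
          A.one_leftHom (ids_vcomp _) _ _
      · refine .cons' (.nil _ _) (Category.comp_id _) (Category.comp_id _)
          (ids_comp (C := Mod C) M.oneHom) (vcomp_ids _) _ _
      · have h := Move.here M.unitBimod A S M.mon.one (idc M.pro) (idc A.pro)
          (CellPath.ids (under S)) (RS := .one M.pro) rfl rfl (ST := .cons M.pro (.one A.pro)) rfl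
          rfl rfl rfl
        rw [show comp (.two (idc M.pro) (idc A.pro) _) A.left _ _ = A.left from ids_comp A.left,
          show comp (P := .one M.pro) (.two M.mon.one (idc M.pro) _) M.mon.mul _ _ = idc M.pro from
            M.mon.one_mul, ← underCells_ids S] at h
        exact h
    | nil =>
      refine ⟨BimodHom.extend χ, BimodHom.one_extend χ, ?_⟩
      · rintro ψ rfl
        -- Uniqueness: left linearity of `ψ` replaces the action on the target by the multiplication
        -- of `M`, with the unit inserted in its second factor. The law `mul_one` then leaves `ψ`.
        refine BimodHom.ext (.symm ?_)
        refine (comp_comp_two T.left (x := .two (idc M.pro) M.mon.one rfl) (isAppend_one _ _ _)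
          (Category.id_comp _) (Category.id_comp _) (Category.id_comp _)
          (ids_comp (MonHom.cell F)) rfl rfl rfl (Category.comp_id _) (Category.comp_id _)
          (Category.id_comp _) (Category.id_comp _) (Category.comp_id _)
          (Category.comp_id _)).symm.trans ?_
        refine (congrArg (fun t => comp _ t _ _) (BimodHom.left ψ).symm).trans ?_
        refine (comp_one_comp _ _ _ (Category.id_comp _) (Category.id_comp _) _ _ _ _
          (Category.id_comp _) (Category.id_comp _)).symm.trans ?_
        refine (congrArg (fun t => comp (.one t) _ _ _) M.mon.mul_one).trans ?_
        exact ids_comp (BimodHom.cell ψ)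

/-- The unit of a monoid in `Mod` is the monoid itself. -/
def Mod.unitOf (M : Mod C) : UnitOf M where
  pro := M.unitBimod
  cell := M.oneHom
  opcartesian := opcartesian_oneHom M

end ModUnits

/-! ### Restrictions in the virtual double category of monoids -/

section ModRestrictions

variable {C : Type u} [Category.{v} C] [VirtualDoubleCategory.{w, z} C]

/-- The restriction of a bimodule along homomorphisms is a bimodule, and the cartesian cell is a
homomorphism. -/
theorem Bimod.exists_restrict {M M' N N' : Mod C} (F : MonHom M N) (G : MonHom M' N')
    (B : Bimod N N') {P : Pro M.obj M'.obj} {κ : Cell F.hom G.hom (.one P) B.pro}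
    (hκ : IsCartesian κ) : ∃ (A : Bimod M M') (φ : BimodHom F G (.one A) B),
      IsCartesian (P := A.pro) φ.cell := by
  -- As for monoids, the two actions are the unique lifts that make `κ` compatible with the actions
  -- on `B`. The axioms are tested after composing with `κ`.
  obtain ⟨l, hl, -⟩ := hκ.existsUnique (Category.id_comp _) (Category.id_comp _)
    (comp (P := .cons M.pro (.one P)) (.two F.cell κ rfl) B.left
      (Category.comp_id _) (Category.comp_id _))
  obtain ⟨r, hr, -⟩ := hκ.existsUnique (Category.id_comp _) (Category.id_comp _)
    (comp (P := .cons P (.one M'.pro)) (.two κ G.cell rfl) B.right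
      (Category.comp_id _) (Category.comp_id _))
  have one_left : comp (P := .one P) (.two M.mon.one (idc P) rfl) l
      (Category.id_comp _) (Category.id_comp _) = idc P := by
    apply hκ.hom_ext (Category.id_comp _) (Category.id_comp _)
    refine (nest_left F.map_one hl (y := .one κ) (.nil _ _) _ rfl).trans ?_
    rw [B.one_left, comp_idc]
    exact (ids_comp κ).symm
  have mul_left : comp (P := .cons M.pro (.cons M.pro (.one P))) (.two M.mon.mul (idc P) rfl) l
      (Category.id_comp _) (Category.id_comp _) =
    comp (P := .cons M.pro (.cons M.pro (.one P))) (.two (idc M.pro) l rfl) l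
      (Category.id_comp _) (Category.id_comp _) := by
    apply hκ.hom_ext (Category.id_comp _) (Category.id_comp _)
    refine (nest_left F.map_mul hl (y := .cons F.cell (.two F.cell κ rfl) rfl)
      (.cons _ (isAppend_one _ _ _) _ _) _ rfl).trans ?_
    rw [B.mul_left]
    exact (nest_right hl hl (isAppend_one _ _ _) _ rfl).symm
  have right_one : comp (P := .one P) (.two (idc P) M'.mon.one rfl) r
      (Category.id_comp _) (Category.id_comp _) = idc P := by
    apply hκ.hom_ext (Category.id_comp _) (Category.id_comp _)
    refine (nest_right G.map_one hr (y := .one κ) (isAppend_nil _) _ rfl).trans ?_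
    rw [B.right_one, comp_idc]
    exact (ids_comp κ).symm
  have right_mul : comp (P := .cons P (.cons M'.pro (.one M'.pro))) (.two (idc P) M'.mon.mul rfl) r
      (Category.id_comp _) (Category.id_comp _) =
    comp (P := .cons P (.cons M'.pro (.one M'.pro))) (.two r (idc M'.pro) rfl) r
      (Category.id_comp _) (Category.id_comp _) := by
    apply hκ.hom_ext (Category.id_comp _) (Category.id_comp _)
    refine (nest_right G.map_mul hr (y := .cons κ (.two G.cell G.cell rfl) rfl)
      (isAppend_one _ _ _) _ rfl).trans ?_
    rw [B.right_mul]
    exact (nest_left hr hr (.cons _ (isAppend_one _ _ _) _ _) _ rfl).symm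
  have left_right : comp (P := .cons M.pro (.cons P (.one M'.pro))) (.two l (idc M'.pro) rfl) r
      (Category.id_comp _) (Category.id_comp _) =
    comp (P := .cons M.pro (.cons P (.one M'.pro))) (.two (idc M.pro) r rfl) l
      (Category.id_comp _) (Category.id_comp _) := by
    apply hκ.hom_ext (Category.id_comp _) (Category.id_comp _)
    refine (nest_left hl hr (y := .cons F.cell (.two κ G.cell rfl) rfl)
      (.cons _ (isAppend_one _ _ _) _ _) _ rfl).trans ?_
    rw [B.left_right]
    exact (nest_right hr hl (isAppend_one _ _ _) _ rfl).symm
  exact ⟨⟨P, l, r, one_left, mul_left, right_one, right_mul, left_right⟩,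
    ⟨κ, hl, hr, innerCompat_one (A := ⟨P, l, r, one_left, mul_left, right_one, right_mul,
      left_right⟩) _⟩, hκ⟩

section

variable {M M' N N' : Mod C} {F : M ⟶ N} {G : M' ⟶ N'} {A : Bimod M M'} {B : Bimod N N'}
  {φ : BimodHom F G (.one A) B} {K K' : Mod C} {H : K ⟶ M} {H' : K' ⟶ M'} {V : K ⟶ N}
  {V' : K' ⟶ N'}

/-- Left linearity of `φ`. It rewrites the action side of a compatibility condition on a lift `ψ` as
the corresponding side for the composite `χ` of `ψ` with `φ`. -/
theorem BimodHom.two_left_comp (hV : H ≫ F = V) (hV' : H' ≫ G = V')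
    {R W : HPath (Pro (C := C)) K.obj K'.obj} (ψ : Cell (MonHom.hom H) (MonHom.hom H') R A.pro)
    {χ : Cell (MonHom.hom V) (MonHom.hom V') R B.pro}
    (hχ : VirtualDoubleStruct.comp (.one ψ) φ.cell (hom_comp_eq hV) (hom_comp_eq hV') = χ)
    (hW : W = (HPath.one K.pro).append R) :
    VirtualDoubleStruct.comp (.one (VirtualDoubleStruct.comp (.two (MonHom.cell H) ψ hW) A.left
      (Category.comp_id _) (Category.comp_id _))) φ.cell (hom_comp_eq hV) (hom_comp_eq hV') =
    VirtualDoubleStruct.comp (.two (MonHom.cell V) χ hW) B.left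
      (Category.comp_id _) (Category.comp_id _) := by
  refine (comp_one_comp _ _ _ _ _ (Category.id_comp _) (Category.id_comp _) (hom_comp_eq hV)
    (hom_comp_eq hV') _ _).trans ?_
  refine (congrArg (fun t => VirtualDoubleStruct.comp _ t _ _) φ.left).trans ?_
  exact comp_comp_two B.left (isAppend_one _ _ _) (hom_comp_eq hV) (hom_comp_eq hV)
    (hom_comp_eq hV') (cell_comp_eq hV) hχ rfl hW _ _ _ _ _ _

theorem BimodHom.two_right_comp (hV : H ≫ F = V) (hV' : H' ≫ G = V')
    {R W : HPath (Pro (C := C)) K.obj K'.obj} (ψ : Cell (MonHom.hom H) (MonHom.hom H') R A.pro)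
    {χ : Cell (MonHom.hom V) (MonHom.hom V') R B.pro}
    (hχ : VirtualDoubleStruct.comp (.one ψ) φ.cell (hom_comp_eq hV) (hom_comp_eq hV') = χ)
    (hW : W = R.append (HPath.one K'.pro)) :
    VirtualDoubleStruct.comp (.one (VirtualDoubleStruct.comp (.two ψ (MonHom.cell H') hW) A.right
      (Category.comp_id _) (Category.comp_id _))) φ.cell (hom_comp_eq hV) (hom_comp_eq hV') =
    VirtualDoubleStruct.comp (.two χ (MonHom.cell V') hW) B.right
      (Category.comp_id _) (Category.comp_id _) := by
  refine (comp_one_comp _ _ _ _ _ (Category.id_comp _) (Category.id_comp _) (hom_comp_eq hV)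
    (hom_comp_eq hV') _ _).trans ?_
  refine (congrArg (fun t => VirtualDoubleStruct.comp _ t _ _) φ.right).trans ?_
  exact comp_comp_two B.right (isAppend_one _ _ _) (hom_comp_eq hV) (hom_comp_eq hV')
    (hom_comp_eq hV') hχ (cell_comp_eq hV') rfl hW _ _ _ _ _ _

end

/-- A bimodule homomorphism is cartesian if its underlying cell is. -/
theorem BimodHom.isCartesian_of_cell {M M' N N' : Mod C} {F : M ⟶ N} {G : M' ⟶ N'}
    {A : Bimod M M'} {B : Bimod N N'} (φ : BimodHom F G (.one A) B)
    (hφ : IsCartesian (P := A.pro) φ.cell) : IsCartesian (C := Mod C) φ := by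
  intro K K' H H' R χ
  obtain ⟨ψ, hψ, huniq⟩ := hφ.existsUnique (hom_comp_eq (F := H) (G := F) rfl)
    (hom_comp_eq (F := H') (G := G) rfl) (BimodHom.cell χ)
  have hcomp : ∀ {W : HPath (Pro (C := C)) K.obj K'.obj} (x : CellPath (𝟙 _) (𝟙 _) W (under R)),
      VirtualDoubleStruct.comp (.one (VirtualDoubleStruct.comp x ψ (Category.id_comp _)
        (Category.id_comp _))) φ.cell (hom_comp_eq (F := H) (G := F) rfl)
        (hom_comp_eq (F := H') (G := G) rfl) =
      VirtualDoubleStruct.comp x (BimodHom.cell χ) (Category.id_comp _) (Category.id_comp _) := by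
    intro W x
    rw [← hψ]
    exact comp_one_comp _ _ _ _ _ _ _ _ _ _ _
  -- The lift taken in `C` is itself a homomorphism: each compatibility condition holds after
  -- composition with `φ`, because `χ` satisfies it, and can be cancelled because the cell of `φ` is
  -- cartesian.
  have hleft : LeftCompat A R H H' ψ := by
    cases R with
    | nil =>
      apply hφ.hom_ext (hom_comp_eq (F := H) (G := F) rfl) (hom_comp_eq (F := H') (G := G) rfl)
      exact (BimodHom.two_left_comp rfl rfl ψ hψ _).trans
        (.trans (BimodHom.left χ) (BimodHom.two_right_comp rfl rfl ψ hψ _).symm)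
    | cons A₀ R =>
      apply hφ.hom_ext (hom_comp_eq (F := H) (G := F) rfl) (hom_comp_eq (F := H') (G := G) rfl)
      exact (hcomp _).trans
        ((BimodHom.left χ).trans (BimodHom.two_left_comp rfl rfl ψ hψ _).symm)
  have hright : RightCompat A R H H' ψ := by
    cases R with
    | nil => trivial
    | cons A₀ R =>
      apply hφ.hom_ext (hom_comp_eq (F := H) (G := F) rfl) (hom_comp_eq (F := H') (G := G) rfl)
      exact (hcomp _).trans
        ((BimodHom.right χ).trans (BimodHom.two_right_comp rfl rfl ψ hψ _).symm)
  have hinner : InnerCompat R ψ := by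
    intro W x y h
    apply hφ.hom_ext (hom_comp_eq (F := H) (G := F) rfl) (hom_comp_eq (F := H') (G := G) rfl)
    exact (hcomp x).trans ((BimodHom.inner χ W x y h).trans (hcomp y).symm)
  exact ⟨⟨ψ, hleft, hright, hinner⟩, BimodHom.ext hψ, fun ψ' h =>
    BimodHom.ext (huniq _ (congrArg BimodHom.cell h))⟩

/-- Units exist in `Mod C` without any assumption on units in `C`. Only the restrictions are taken
from `C`. -/
theorem isVirtualEquipment_mod (hC : IsVirtualEquipment C) : IsVirtualEquipment (Mod C) where
  has_units M := ⟨M.unitOf⟩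
  has_restrictions F G B := by
    obtain ⟨P, κ, hκ⟩ := hC.has_restrictions (MonHom.hom F) (MonHom.hom G) (Bimod.pro B)
    obtain ⟨A, φ, hφ⟩ := Bimod.exists_restrict F G B hκ
    exact ⟨A, φ, φ.isCartesian_of_cell hφ⟩

theorem IsIsoCell.under {M M' N N' : Mod C} {F : M ⟶ N} {G : M' ⟶ N'}
    {A : Bimod M M'} {B : Bimod N N'} {φ : BimodHom F G (.one A) B}
    (h : IsIsoCell (C := Mod C) φ) : IsIsoCell (P := A.pro) φ.cell := by
  obtain ⟨F', G', ψ, hF, hG, hF', hG', h₁, h₂⟩ := h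
  exact ⟨_, _, BimodHom.cell ψ, hom_comp_eq hF, hom_comp_eq hG, hom_comp_eq hF',
    hom_comp_eq hG', congrArg BimodHom.cell h₁, congrArg BimodHom.cell h₂⟩

/-- Over invertible vertical arrows of `C`, the cartesian homomorphisms are those with invertible
underlying cell. -/
theorem BimodHom.isCartesian_iff_isIsoCell (hC : IsVirtualEquipment C) {M M' N N' : Mod C}
    {F : M ⟶ N} {G : M' ⟶ N'} (hF : IsIso (MonHom.hom F)) (hG : IsIso (MonHom.hom G))
    {A : Bimod M M'} {B : Bimod N N'} (φ : BimodHom F G (.one A) B) :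
    IsCartesian (C := Mod C) φ ↔ IsIsoCell (P := A.pro) φ.cell := by
  refine ⟨fun h => ?_, fun h => φ.isCartesian_of_cell h.isCartesian⟩
  -- Cartesianness in `Mod C` does not visibly pass to the underlying cell. So `φ` is compared with
  -- a restriction built from one in `C`: the comparison is invertible, and the constructed cell is
  -- invertible because its frames in `C` are.
  obtain ⟨P, κ, hκ⟩ := hC.has_restrictions (MonHom.hom F) (MonHom.hom G) B.pro
  obtain ⟨A', κ', hκ'⟩ := Bimod.exists_restrict F G B hκ
  obtain ⟨θ, hθ, e⟩ := (κ'.isCartesian_of_cell hκ').exists_iso h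
  have := hθ.under.comp hκ'.isIsoCell (Category.id_comp _) (Category.id_comp _)
  exact congrArg BimodHom.cell e ▸ this

end ModRestrictions

/-! ### Independence of the choice of units -/

section ChangeUnit

variable {C : Type u} [Category.{v} C] [VirtualDoubleCategory.{w, z} C]

/-- The computation behind `Units.trivialHom`, for two units that need not come from one choice. It
is needed when `k` is an identity and the two units differ. -/
theorem UnitOf.map_mul {x y : C} (η : UnitOf x) (θ : UnitOf y) (k : x ⟶ y) :
    comp (.one (η.actL η.pro)) (η.map θ k) (Category.id_comp k) (Category.id_comp k) =
      comp (P := .cons η.pro (.one η.pro)) (.two (η.map θ k) (η.map θ k) rfl) (θ.actL θ.pro)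
        (Category.comp_id k) (Category.comp_id k) := by
  apply η.ext_left
  refine (assoc _ (vcomp_one _ _ (Category.id_comp _) (Category.id_comp _)) _ _ _ _
    (Category.id_comp k) (Category.id_comp k)).trans ?_
  refine .trans ?_ (comp_comp_two _ (isAppend_one _ _ _) (Category.id_comp k)
    (Category.id_comp k) (Category.id_comp k) (η.unit_map θ k) (ids_comp _) rfl rfl _ _ _ _
    (Category.comp_id k) (Category.comp_id k)).symm
  refine .trans ?_ (θ.two_actL _ _ rfl).symm
  refine .trans ?_ (ids_comp _)
  exact congrArg (fun t => comp (.one t) _ _ _) (η.unit_actL η.pro)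

/-- After inserting the unit cell of `η`, both sides become the identity of `P`. -/
theorem UnitOf.two_map_actL {x y : C} (η θ : UnitOf x) (P : Pro x y) :
    comp (P := .cons η.pro (.one P)) (.two (η.map θ (𝟙 x)) (idc P) rfl) (θ.actL P)
      (Category.id_comp _) (Category.id_comp _) = η.actL P := by
  apply η.ext_left
  refine (comp_comp_two _ (isAppend_one _ _ _) (Category.id_comp _) (Category.id_comp _)
    (Category.id_comp _) (η.unit_map θ _) (ids_comp _) rfl rfl _ _ _ _ (Category.comp_id _)
    (Category.comp_id _)).trans ?_
  exact (θ.two_actL P _ rfl).trans (η.unit_actL P).symm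

theorem UnitOf.two_map_actR {x y : C} (η θ : UnitOf y) (P : Pro x y) :
    comp (P := .cons P (.one η.pro)) (.two (idc P) (η.map θ (𝟙 y)) rfl) (θ.actR P)
      (Category.id_comp _) (Category.id_comp _) = η.actR P := by
  apply η.ext_right (R := .one P)
  refine (comp_comp_two _ (isAppend_one _ _ _) (Category.id_comp _) (Category.id_comp _)
    (Category.id_comp _) (ids_comp _) (η.unit_map θ _) rfl rfl _ _ _ _ (Category.comp_id _)
    (Category.comp_id _)).trans ?_
  exact (θ.two_actR P _ rfl).trans (η.unit_actR P).symm

/-- Transport of an embedding along a change of the unit of its target. -/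
@[reducible]
noncomputable def MonHom.changeUnit {M : Mod C} {x : C} {η : UnitOf x}
    (i : MonHom M ⟨x, η.trivialOn⟩) (θ : UnitOf x) : MonHom M ⟨x, θ.trivialOn⟩ where
  hom := i.hom
  cell := VirtualDoubleStruct.comp (.one i.cell) (η.map θ (𝟙 x)) (Category.comp_id _)
    (Category.comp_id _)
  map_one := by
    refine (comp_one_comp _ _ _ (Category.id_comp _) (Category.id_comp _) _ _ _ _
      (Category.comp_id _) (Category.comp_id _)).symm.trans ?_
    rw [i.map_one]
    refine (comp_one_comp (.nil i.hom) η.cell _ _ _ (Category.id_comp _) (Category.id_comp _)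
      (Category.comp_id _) (Category.comp_id _) _ _).trans ?_
    rw [η.unit_map θ]
    exact assoc _ (.nil (Category.comp_id _)) _ _ _ _ _ _
  map_mul := by
    refine (comp_one_comp _ _ _ (Category.id_comp _) (Category.id_comp _) _ _ _ _
      (Category.comp_id _) (Category.comp_id _)).symm.trans ?_
    rw [i.map_mul]
    refine (comp_one_comp (P := .cons M.pro (.one M.pro)) (.two i.cell i.cell rfl) _ _ _ _
      (Category.id_comp _) (Category.id_comp _) (Category.comp_id _) (Category.comp_id _)
      _ _).trans ?_
    rw [η.map_mul θ]
    exact comp_comp_two _ (isAppend_one _ _ _) (Category.comp_id _) (Category.comp_id _)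
      (Category.comp_id _) rfl rfl _ _ _ _ _ _ _ _

theorem MonHom.ext_cell {M N : Mod C} {f : M.obj ⟶ N.obj} {φ ψ : Cell f f (.one M.pro) N.pro}
    {h₁ h₂ h₃ h₄} (h : φ = ψ) : (⟨f, φ, h₁, h₂⟩ : MonHom M N) = ⟨f, ψ, h₃, h₄⟩ := by
  subst h
  rfl

/-- The comparison cells in the two directions compose to the cell induced by an identity arrow,
which is an identity. -/
theorem MonHom.changeUnit_changeUnit {M : Mod C} {x : C} {η : UnitOf x}
    (i : MonHom M ⟨x, η.trivialOn⟩) (θ : UnitOf x) : (i.changeUnit θ).changeUnit η = i := by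
  refine MonHom.ext_cell ?_
  refine (comp_one_comp _ _ _ _ _ (Category.id_comp _) (Category.id_comp _)
    (Category.comp_id _) (Category.comp_id _) _ _).trans ?_
  rw [η.map_comp θ η _ _ (Category.id_comp _), η.map_id, comp_idc]

/-- This makes the linearity conditions of a bimodule embedding independent of the unit that is used
to state them. -/
theorem two_actL_changeUnit {M : Mod C} {x y b : C} {η : UnitOf x}
    (i : MonHom M ⟨x, η.trivialOn⟩) (θ : UnitOf x) {R : HPath (Pro (C := C)) M.obj b}
    {P : Pro x y} {g : b ⟶ y} (φ : Cell i.hom g R P) :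
    comp (P := .cons M.pro R) (.two i.cell φ rfl) (η.actL P) (Category.comp_id _)
        (Category.comp_id _) =
      comp (P := .cons M.pro R) (.two (i.changeUnit θ).cell φ rfl) (θ.actL P)
        (Category.comp_id _) (Category.comp_id _) := by
  rw [← η.two_map_actL θ P]
  exact comp_comp_two _ (isAppend_one _ _ _) (Category.comp_id _) (Category.comp_id _)
    (Category.comp_id _) rfl (comp_idc _) _ _ _ _ _ _ _ _

theorem two_actR_changeUnit {M : Mod C} {x y b : C} {η : UnitOf y}
    (i : MonHom M ⟨y, η.trivialOn⟩) (θ : UnitOf y) {R : HPath (Pro (C := C)) b M.obj}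
    {P : Pro x y} {g : b ⟶ x} (φ : Cell g i.hom R P) :
    comp (.two φ i.cell rfl) (η.actR P) (Category.comp_id _) (Category.comp_id _) =
      comp (.two φ (i.changeUnit θ).cell rfl) (θ.actR P)
        (Category.comp_id _) (Category.comp_id _) := by
  rw [← η.two_map_actR θ P]
  exact comp_comp_two _ (isAppend_one _ _ _) (Category.comp_id _) (Category.comp_id _)
    (Category.comp_id _) (comp_idc _) rfl _ _ _ _ _ _ _ _

end ChangeUnit

/-! ### Total monoids and total bimodules -/

section Total

variable {C : Type u} [Category.{v} C] [VirtualDoubleCategory.{w, z} C]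

/-- A monoid homomorphism, as a homomorphism of unit bimodules. -/
def MonHom.toBimodHom {M N : Mod C} (F : MonHom M N) :
    BimodHom F F (.one M.unitBimod) N.unitBimod where
  cell := F.cell
  left := F.map_mul
  right := F.map_mul
  inner := innerCompat_one _

theorem Mod.unitOf_map {M N : Mod C} (F : M ⟶ N) :
    M.unitOf.map N.unitOf F = MonHom.toBimodHom F :=
  M.unitOf.hom_ext ((M.unitOf.unit_map N.unitOf F).trans (BimodHom.ext (MonHom.map_one F).symm))

/-- The action of a unit is obtained by choice from opcartesianness. The unit law of `A`
characterises it, which identifies it with the given action. -/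
theorem Mod.unitOf_actL {M N : Mod C} (A : Bimod M N) : M.unitOf.actL A = A.leftHom :=
  M.unitOf.ext_left (S := .one (Pro := Pro (C := Mod C)) A)
    ((M.unitOf.unit_actL A).trans A.one_leftHom.symm)

theorem Mod.unitOf_actR {M N : Mod C} (A : Bimod M N) : N.unitOf.actR A = A.rightHom :=
  N.unitOf.ext_right (R := .one (Pro := Pro (C := Mod C)) A)
    ((N.unitOf.unit_actR A).trans A.rightHom_one.symm)

/-- The monoid in `C` underlying a monoid in `Mod C`. -/
@[reducible]
def MonoidOn.total {X : Mod C} (M : MonoidOn X) : Mod C where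
  obj := X.obj
  mon :=
    { pro := Bimod.pro M.pro
      one := BimodHom.cell M.one
      mul := BimodHom.cell M.mul
      one_mul := congrArg BimodHom.cell M.one_mul
      mul_one := congrArg BimodHom.cell M.mul_one
      mul_assoc := congrArg BimodHom.cell M.mul_assoc }

/-- The bimodule in `C` underlying a bimodule in `Mod C`. -/
@[reducible]
def Bimod.total {X Y : Mod C} {M : MonoidOn X} {N : MonoidOn Y}
    (B : Bimod (⟨X, M⟩ : Mod (Mod C)) ⟨Y, N⟩) : Bimod M.total N.total where
  pro := Bimod.pro (M := X) (N := Y) B.pro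
  left := BimodHom.cell B.left
  right := BimodHom.cell B.right
  one_left := congrArg BimodHom.cell B.one_left
  mul_left := congrArg BimodHom.cell B.mul_left
  right_one := congrArg BimodHom.cell B.right_one
  right_mul := congrArg BimodHom.cell B.right_mul
  left_right := congrArg BimodHom.cell B.left_right

/-- The homomorphism in `C` underlying a homomorphism to a unit in `Mod C`. -/
def MonHom.total {X Y : Mod C} {M : MonoidOn X}
    (i : MonHom (⟨X, M⟩ : Mod (Mod C)) ⟨Y, Y.unitOf.trivialOn⟩) : MonHom M.total Y where
  hom := MonHom.hom (M := X) (N := Y) i.hom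
  cell := BimodHom.cell i.cell
  map_one := congrArg BimodHom.cell i.map_one
  map_mul := by
    -- The trivial monoid on `Y` multiplies by the abstract action of the unit on itself, which is
    -- the multiplication of `Y`.
    refine (congrArg BimodHom.cell i.map_mul).trans ?_
    exact congrArg (fun t => VirtualDoubleStruct.comp (P := .cons _ (.one _)) (.two (BimodHom.cell i.cell)
      (BimodHom.cell i.cell) rfl) (BimodHom.cell t) (Category.comp_id _) (Category.comp_id _))
      (Mod.unitOf_actL Y.unitBimod)

/-- The extension of the unit of a monoid in `Mod C` is multiplicative. -/
theorem MonoidOn.mul_extend {X : Mod C} (M : MonoidOn X) :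
    comp (C := Mod C) (.one (C := Mod C) X.unitBimod.leftHom) (BimodHom.extend M.one)
        (Category.id_comp _) (Category.id_comp _) =
      comp (C := Mod C) (P := .cons X.unitBimod (.one X.unitBimod))
        (.two (C := Mod C) (BimodHom.extend M.one) (BimodHom.extend M.one) rfl) M.mul
        (Category.id_comp _) (Category.id_comp _) := by
  -- It is enough to compare after inserting the unit of `X` on the left. The left side reduces by
  -- the unit law of `X` and the right side by that of `M`, both to the extension of the unit of
  -- `M`.
  apply X.unitOf.ext_left (S := .one (Pro := Pro (C := Mod C)) X.unitBimod)
  refine (assoc (C := Mod C) _ (vcomp_one _ _ (Category.id_comp _) (Category.id_comp _)) _ _ _ _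
    (Category.id_comp _) (Category.id_comp _)).trans ?_
  refine .trans ?_ (comp_comp_two (C := Mod C) _ (isAppend_one _ _ _) (Category.id_comp _)
    (Category.id_comp _) (Category.id_comp _) (BimodHom.one_extend M.one) (ids_comp _) rfl rfl
    _ _ _ _ (Category.comp_id _) (Category.comp_id _)).symm
  refine (congrArg (fun t => comp (C := Mod C) (.one (C := Mod C) t) _ _ _)
    X.unitBimod.one_leftHom).trans ?_
  refine (ids_comp (C := Mod C) (BimodHom.extend M.one)).trans ?_
  refine .trans ?_ (comp_comp_two (C := Mod C) (x := .one (BimodHom.extend M.one)) _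
    (.nil (C := Mod C) (𝟙 X) _) (Category.id_comp _) (Category.id_comp _)
    (Category.id_comp _) (ids_comp M.one) (comp_idc _) rfl rfl (Category.id_comp _)
    (Category.id_comp _) (Category.id_comp _) (Category.id_comp _) _ _)
  rw [M.one_mul]
  exact (comp_idc (C := Mod C) (BimodHom.extend M.one)).symm

/-- The homomorphism from the base of a monoid in `Mod C` to its underlying monoid. -/
def MonoidOn.unitHom {X : Mod C} (M : MonoidOn X) : X ⟶ M.total where
  hom := 𝟙 X.obj
  cell := BimodHom.cell (BimodHom.extend M.one)
  map_one := (congrArg BimodHom.cell (BimodHom.one_extend M.one)).trans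
    (ids_comp (BimodHom.cell M.one)).symm
  map_mul := congrArg BimodHom.cell M.mul_extend

/-- The action of `X` on `B` is the restriction along `X → M.total` of the action of `M`.
Consequently, linearity over the total monoid already implies linearity over `X`. -/
theorem Bimod.two_extend_left {X : Mod C} {M : MonoidOn X} {N : Mod (Mod C)}
    (B : Bimod (⟨X, M⟩ : Mod (Mod C)) N) :
    comp (C := Mod C) (P := .cons X.unitBimod (.one B.pro))
      (.two (C := Mod C) (BimodHom.extend M.one) (idc B.pro) rfl) B.left
      (Category.id_comp _) (Category.id_comp _) = Bimod.leftHom B.pro := by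
  apply X.unitOf.ext_left (S := .one (Pro := Pro (C := Mod C)) B.pro)
  refine (comp_comp_two (C := Mod C) _ (isAppend_one _ _ _) (Category.id_comp _)
    (Category.id_comp _) (Category.id_comp _) (BimodHom.one_extend M.one) (ids_comp _) rfl rfl
    _ _ _ _ (Category.comp_id _) (Category.comp_id _)).trans ?_
  exact B.one_left.trans (Bimod.one_leftHom _).symm

theorem Bimod.two_extend_right {X : Mod C} {M : MonoidOn X} {N : Mod (Mod C)}
    (B : Bimod N (⟨X, M⟩ : Mod (Mod C))) :
    comp (C := Mod C) (P := .cons B.pro (.one X.unitBimod))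
      (.two (C := Mod C) (idc B.pro) (BimodHom.extend M.one) rfl) B.right
      (Category.id_comp _) (Category.id_comp _) = Bimod.rightHom B.pro := by
  apply X.unitOf.ext_right (R := .one (Pro := Pro (C := Mod C)) B.pro)
  refine (comp_comp_two (C := Mod C) _ (isAppend_one _ _ _) (Category.id_comp _)
    (Category.id_comp _) (Category.id_comp _) (ids_comp _) (BimodHom.one_extend M.one) rfl rfl
    _ _ _ _ (Category.comp_id _) (Category.comp_id _)).trans ?_
  exact B.right_one.trans (Bimod.rightHom_one _).symm

end Total

/-! ### Embeddings and collapses of monoids -/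

section Collapse

variable {C : Type u} [Category.{v} C] [VirtualDoubleCategory.{w, z} C]

/-- Since `i` preserves units, both homomorphisms restrict to the same nullary cell along the unit
of `X`, and that cell determines them. -/
theorem unitHom_comp_total {X Y : Mod C} {M : MonoidOn X}
    (i : MonHom (⟨X, M⟩ : Mod (Mod C)) ⟨Y, Y.unitOf.trivialOn⟩) :
    M.unitHom ≫ (i.total : M.total ⟶ Y) = i.hom := by
  have h : comp (C := Mod C) (.one (C := Mod C) (BimodHom.extend M.one)) i.cell
      (Category.id_comp _) (Category.id_comp _) = MonHom.toBimodHom i.hom := by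
    apply X.unitOf.hom_ext
    refine (assoc (C := Mod C) _ (vcomp_one _ _ (Category.id_comp _) (Category.id_comp _)) _ _ _ _
      (Category.id_comp _) (Category.id_comp _)).trans ?_
    refine (congrArg (fun t => comp (C := Mod C) (.one (C := Mod C) t) _ _ _)
      (BimodHom.one_extend M.one)).trans ?_
    exact i.map_one.trans (BimodHom.ext (MonHom.map_one (M := X) (N := Y) i.hom).symm)
  refine MonHom.ext_comp (Category.id_comp _) ?_
  refine (comp_one_comp _ _ _ _ _ (Category.comp_id _) (Category.comp_id _)
    (Category.id_comp _) (Category.id_comp _) _ _).trans ?_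
  exact (congrArg (fun t => comp _ t _ _) (comp_idc (C := C) _)).trans (congrArg BimodHom.cell h)

/-- The frame of an embedding is a homomorphism `X ⟶ Y`, with a cell of its own that `total`
discards. The preceding lemma recovers it, and the remaining datum is the underlying cell. -/
theorem total_injective {X Y : Mod C} {M : MonoidOn X}
    {i j : MonHom (⟨X, M⟩ : Mod (Mod C)) ⟨Y, Y.unitOf.trivialOn⟩} (h : i.total = j.total) :
    i = j := by
  have h' : i.hom = j.hom := by rw [← unitHom_comp_total i, ← unitHom_comp_total j, h]
  obtain ⟨f, φ, _, _⟩ := i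
  obtain ⟨g, ψ, _, _⟩ := j
  dsimp only at h'
  subst h'
  refine MonHom.ext_cell (BimodHom.ext ?_)
  have := MonHom.mk.inj h
  exact eq_of_heq this.2

/-- The identity of the underlying monoid of a monoid in `Mod C`, as a homomorphism to a unit. -/
noncomputable def MonoidOn.totalHom {X : Mod C} (M : MonoidOn X) :
    MonHom (⟨X, M⟩ : Mod (Mod C)) ⟨M.total, M.total.unitOf.trivialOn⟩ where
  hom := M.unitHom
  cell :=
    { cell := idc M.total.pro
      -- For an identity cell, linearity over `X` says precisely that the action of `X` on `M` is
      -- multiplication by the image of `X` in the total monoid.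
      left := (comp_idc (C := C) _).trans (congrArg BimodHom.cell
        (Bimod.two_extend_left (Mod.unitBimod (⟨X, M⟩ : Mod (Mod C))))).symm
      right := (comp_idc (C := C) _).trans (congrArg BimodHom.cell
        (Bimod.two_extend_right (Mod.unitBimod (⟨X, M⟩ : Mod (Mod C))))).symm
      inner := innerCompat_one _ }
  map_one := BimodHom.ext ((comp_idc (C := C) _).trans (ids_comp (BimodHom.cell M.one)).symm)
  map_mul := by
    refine BimodHom.ext ((comp_idc (C := C) _).trans ?_)
    refine .trans ?_ (congrArg (fun t => comp (P := .cons _ (.one _)) (.two (idc M.total.pro)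
      (idc M.total.pro) rfl) (BimodHom.cell t) (Category.comp_id _) (Category.comp_id _))
      (Mod.unitOf_actL M.total.unitBimod)).symm
    exact (ids_comp (C := C) _).symm

theorem MonoidOn.total_totalHom {X : Mod C} (M : MonoidOn X) :
    M.totalHom.total = 𝟙 M.total := rfl

variable {U : Units (Mod C)}

/-- The homomorphism out of the underlying monoid that corresponds to an embedding. -/
noncomputable def embHom {X Y : Mod C} {M : MonoidOn X} (i : Emb U M Y) : M.total ⟶ Y :=
  (i.changeUnit Y.unitOf).total

theorem unitHom_comp_embHom {X Y : Mod C} {M : MonoidOn X} (i : Emb U M Y) :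
    M.unitHom ≫ embHom i = i.hom :=
  unitHom_comp_total _

theorem embHom_injective {X Y : Mod C} {M : MonoidOn X} {i j : Emb U M Y}
    (h : embHom i = embHom j) : i = j := by
  rw [← i.changeUnit_changeUnit Y.unitOf, ← j.changeUnit_changeUnit Y.unitOf,
    total_injective h]

/-- Naturality in `Y`: passing from the chosen unit of `Y` to the canonical unit of `Y'` along `h`
gives the same cell whether the unit is changed before or after `h`. -/
theorem embHom_comp {X Y Y' : Mod C} {M : MonoidOn X} (i : Emb U M Y) (h : Y ⟶ Y') :
    embHom (i.comp (U.trivialHom h)) = embHom i ≫ h := by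
  have e : comp (C := Mod C) (.one (C := Mod C) (i.comp (U.trivialHom h)).cell)
      ((U.unit Y').map Y'.unitOf (𝟙 Y')) (Category.comp_id _) (Category.comp_id _) =
      comp (C := Mod C) (.one (C := Mod C) (i.changeUnit Y.unitOf).cell)
        (MonHom.toBimodHom h) rfl rfl := by
    refine (comp_one_comp (C := Mod C) _ _ _ _ _ (Category.comp_id h) (Category.comp_id h)
      rfl rfl _ _).trans ?_
    refine .trans ?_ (comp_one_comp (C := Mod C) _ _ _ _ _ (Category.id_comp h)
      (Category.id_comp h) rfl rfl _ _).symm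
    rw [← Mod.unitOf_map, UnitOf.map_comp, UnitOf.map_comp]
  exact MonHom.ext_cell (congrArg BimodHom.cell e)

-- With injectivity and naturality, this universal element shows that the total monoid represents
-- the embeddings of `M`.
variable (U) in
theorem exists_embHom_eq_id {X : Mod C} (M : MonoidOn X) :
    ∃ i : Emb U M M.total, embHom i = 𝟙 M.total :=
  ⟨M.totalHom.changeUnit (U.unit M.total), by
    unfold embHom
    rw [MonHom.changeUnit_changeUnit, MonoidOn.total_totalHom]⟩

theorem IsCollapse.of_isIso {X Y : Mod C} {M : MonoidOn X} (i : Emb U M Y)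
    [IsIso (embHom i)] : IsCollapse i := by
  intro Z j
  refine ⟨inv (embHom i) ≫ embHom j, embHom_injective ?_, ?_⟩
  · rw [embHom_comp, IsIso.hom_inv_id_assoc]
  · rintro k rfl
    rw [embHom_comp, IsIso.inv_hom_id_assoc]

/-- Factoring the universal element through `i` gives a retraction `k` of `embHom i`. The
endomorphism `k ≫ embHom i` of `Y` and the identity both factor `i` through itself, so they agree.
-/
theorem IsCollapse.isIso {X Y : Mod C} {M : MonoidOn X} {i : Emb U M Y}
    (hi : IsCollapse i) : IsIso (embHom i) := by
  obtain ⟨j, hj⟩ := exists_embHom_eq_id U M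
  obtain ⟨k, hk, -⟩ := hi j
  have h : embHom i ≫ k = 𝟙 _ := by rw [← embHom_comp, hk, hj]
  refine ⟨k, h, (hi i).unique (embHom_injective ?_) (embHom_injective ?_)⟩
  · rw [embHom_comp, ← Category.assoc, h, Category.id_comp]
  · rw [embHom_comp, Category.comp_id]

/-! ### Embeddings of bimodules as homomorphisms of total bimodules -/

section Bimodules

variable {X X' Y Y' : Mod C} {M : MonoidOn X} {N : MonoidOn X'} {i : Emb U M Y} {j : Emb U N Y'}
  {B : Bimod (⟨X, M⟩ : Mod (Mod C)) ⟨X', N⟩} {Q : Bimod Y Y'}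

/-- The 2-cell of `Mod C` underlying an embedding of a bimodule. -/
abbrev embCell (φ : BimodEmb U i j B Q) :
    BimodHom (M := X) (N := X') i.hom j.hom (.one B.pro) Q := φ.cell

/-- The homomorphism of underlying bimodules that corresponds to an embedding. -/
noncomputable def bimodEmbHom (φ : BimodEmb U i j B Q) :
    BimodHom (embHom i) (embHom j) (.one B.total) Q where
  cell := (embCell φ).cell
  left := by
    -- The condition on `φ` is stated with the action of the chosen unit. It is carried to the
    -- canonical unit, whose action on `Q` is the given left action.
    refine (congrArg BimodHom.cell φ.left).trans ?_
    refine (congrArg BimodHom.cell (two_actL_changeUnit i Y.unitOf φ.cell)).trans ?_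
    exact congrArg (fun t => comp (P := .cons _ (.one _)) (.two (MonHom.cell (embHom i))
      (embCell φ).cell rfl) (BimodHom.cell t) (Category.comp_id _) (Category.comp_id _))
      (Mod.unitOf_actL Q)
  right := by
    refine (congrArg BimodHom.cell φ.right).trans ?_
    refine (congrArg BimodHom.cell (two_actR_changeUnit j Y'.unitOf φ.cell)).trans ?_
    exact congrArg (fun t => comp (P := .cons _ (.one _)) (.two (embCell φ).cell
      (MonHom.cell (embHom j)) rfl) (BimodHom.cell t) (Category.comp_id _) (Category.comp_id _))
      (Mod.unitOf_actR Q)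
  inner := innerCompat_one _

/-- Linearity is needed at two levels: over `X` and `X'`, for a 2-cell of `Mod C`, and over `M` and
`N`, for an embedding. The first follows by restricting the linearity of `ψ` along the unit
homomorphisms; the second is the linearity of `ψ` itself after a change of unit. -/
theorem exists_bimodEmb (ψ : BimodHom (embHom i) (embHom j) (.one B.total) Q) :
    ∃ φ : BimodEmb U i j B Q, (embCell φ).cell = ψ.cell := by
  have hleft : LeftCompat (M := X) (N := X') Q (.one B.pro) i.hom j.hom ψ.cell := by
    refine (congrArg (fun t => comp (.one t) ψ.cell (Category.id_comp _) (Category.id_comp _))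
      (congrArg BimodHom.cell B.two_extend_left)).symm.trans ?_
    refine (comp_one_comp _ _ _ _ _ (Category.id_comp _) (Category.id_comp _)
      (Category.id_comp _) (Category.id_comp _) _ _).trans ?_
    refine (congrArg (fun t => comp _ t _ _) ψ.left).trans ?_
    exact comp_comp_two Q.left (isAppend_one _ _ _) (Category.id_comp _) (Category.id_comp _)
      (Category.id_comp _) (cell_comp_eq (unitHom_comp_embHom i)) (ids_comp ψ.cell) rfl rfl
      _ _ _ _ _ _
  have hright : RightCompat (M := X) (N := X') Q (.one B.pro) i.hom j.hom ψ.cell := by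
    refine (congrArg (fun t => comp (.one t) ψ.cell (Category.id_comp _) (Category.id_comp _))
      (congrArg BimodHom.cell B.two_extend_right)).symm.trans ?_
    refine (comp_one_comp _ _ _ _ _ (Category.id_comp _) (Category.id_comp _)
      (Category.id_comp _) (Category.id_comp _) _ _).trans ?_
    refine (congrArg (fun t => comp _ t _ _) ψ.right).trans ?_
    exact comp_comp_two Q.right (isAppend_one _ _ _) (Category.id_comp _) (Category.id_comp _)
      (Category.id_comp _) (ids_comp ψ.cell) (cell_comp_eq (unitHom_comp_embHom j)) rfl rfl
      _ _ _ _ _ _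
  let φ : BimodHom (M := X) (N := X') i.hom j.hom (.one B.pro) Q :=
    ⟨ψ.cell, hleft, hright, innerCompat_one _⟩
  refine ⟨⟨φ, ?_, ?_, innerCompat_one _⟩, rfl⟩
  · refine .trans ?_ (two_actL_changeUnit i Y.unitOf φ).symm
    refine BimodHom.ext (.trans ψ.left ?_)
    exact congrArg (fun t => comp (P := .cons _ (.one _)) (.two (MonHom.cell (embHom i))
      ψ.cell rfl) (BimodHom.cell t) (Category.comp_id _) (Category.comp_id _))
      (Mod.unitOf_actL Q).symm
  · refine .trans ?_ (two_actR_changeUnit j Y'.unitOf φ).symm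
    refine BimodHom.ext (.trans ψ.right ?_)
    exact congrArg (fun t => comp (P := .cons _ (.one _)) (.two ψ.cell
      (MonHom.cell (embHom j)) rfl) (BimodHom.cell t) (Category.comp_id _) (Category.comp_id _))
      (Mod.unitOf_actR Q).symm

end Bimodules

end Collapse

/-! ### Invertible cells and invertible homomorphisms -/

section Iso

variable {C : Type u} [Category.{v} C] [VirtualDoubleCategory.{w, z} C]

/-- An equation between composites does not depend on the chosen form of the frames. -/
theorem comp_eq_comp_congr {a b a' b' c' d' a'' b'' : C} {f : a ⟶ a'} {g : b ⟶ b'}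
    {f' : a' ⟶ a''} {g' : b' ⟶ b''} {h : a ⟶ c'} {k : b ⟶ d'} {h' : c' ⟶ a''} {k' : d' ⟶ b''}
    {u u' : a ⟶ a''} {v v' : b ⟶ b''} {P : HPath (Pro (C := C)) a b}
    {Q : HPath (Pro (C := C)) a' b'} {R : HPath (Pro (C := C)) c' d'} {B : Pro a'' b''}
    {x : CellPath f g P Q} {φ : Cell f' g' Q B} {y : CellPath h k P R} {ψ : Cell h' k' R B}
    {hu : f ≫ f' = u} {hv : g ≫ g' = v} {hu₁ : h ≫ h' = u} {hv₁ : k ≫ k' = v}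
    (e : comp x φ hu hv = comp y ψ hu₁ hv₁)
    (hu' : f ≫ f' = u') (hv' : g ≫ g' = v') (hu₁' : h ≫ h' = u') (hv₁' : k ≫ k' = v') :
    comp x φ hu' hv' = comp y ψ hu₁' hv₁' := by
  obtain rfl : u = u' := hu.symm.trans hu'
  obtain rfl : v = v' := hv.symm.trans hv'
  exact e

theorem comp_idc_eq_idc_comp {a b a' b' : C} {f : a ⟶ a'} {g : b ⟶ b'} {P : Pro a b}
    {Q : Pro a' b'} (φ : Cell f g (.one P) Q) {u : a ⟶ a'} {v : b ⟶ b'} (hu : f ≫ 𝟙 _ = u)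
    (hv : g ≫ 𝟙 _ = v) (hu' : 𝟙 _ ≫ f = u) (hv' : 𝟙 _ ≫ g = v) :
    comp (.one φ) (idc Q) hu hv = comp (.one (idc P)) φ hu' hv' :=
  comp_eq_comp_congr ((comp_idc φ).trans (ids_comp φ).symm) _ _ _ _

/-- Precomposition with an invertible cell is bijective. -/
theorem IsIsoCell.existsUnique_precomp {a b a' b' : C} {f : a ⟶ a'} {g : b ⟶ b'} {P : Pro a b}
    {Q : Pro a' b'} {φ : Cell f g (.one P) Q} (hφ : IsIsoCell φ) {a'' b'' : C} {h : a' ⟶ a''}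
    {k : b' ⟶ b''} {u : a ⟶ a''} {v : b ⟶ b''} (hu : f ≫ h = u) (hv : g ≫ k = v) {R : Pro a'' b''}
    (ψ : Cell u v (.one P) R) : ∃! χ : Cell h k (.one Q) R,
      VirtualDoubleStruct.comp (.one φ) χ hu hv = ψ := by
  obtain ⟨f', g', φ', hf, hg, hf', hg', h₁, h₂⟩ := hφ
  have e₁ : f' ≫ u = h := by rw [← hu, ← Category.assoc, hf', Category.id_comp]
  have e₂ : g' ≫ v = k := by rw [← hv, ← Category.assoc, hg', Category.id_comp]
  refine ⟨VirtualDoubleStruct.comp (.one φ') ψ e₁ e₂, ?_, ?_⟩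
  · refine (comp_one_comp _ _ _ hf hg _ _ _ _ (Category.id_comp u)
      (Category.id_comp v)).symm.trans ?_
    rw [h₁]
    exact ids_comp ψ
  · rintro χ rfl
    refine .symm ((comp_one_comp _ _ _ hf' hg' _ _ _ _ (Category.id_comp h)
      (Category.id_comp k)).symm.trans ?_)
    rw [h₂]
    exact ids_comp χ

theorem UnitOf.isIsoCell_map {x : C} (η θ : UnitOf x) : IsIsoCell (η.map θ (𝟙 x)) :=
  ⟨𝟙 x, 𝟙 x, θ.map η (𝟙 x), by simp, by simp, by simp, by simp,
    (η.map_comp θ η _ _ (Category.id_comp _)).trans η.map_id,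
    (θ.map_comp η θ _ _ (Category.id_comp _)).trans θ.map_id⟩

theorem MonHom.isIsoCell_cell {M N : Mod C} (F : M ⟶ N) [IsIso F] : IsIsoCell (MonHom.cell F) :=
  ⟨_, _, MonHom.cell (inv F), hom_comp_eq (IsIso.hom_inv_id F), hom_comp_eq (IsIso.hom_inv_id F),
    hom_comp_eq (IsIso.inv_hom_id F), hom_comp_eq (IsIso.inv_hom_id F),
    cell_comp_eq (IsIso.hom_inv_id F), cell_comp_eq (IsIso.inv_hom_id F)⟩

theorem MonHom.isIso_hom {M N : Mod C} (F : M ⟶ N) [IsIso F] : IsIso (MonHom.hom F) :=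
  ⟨MonHom.hom (inv F), hom_comp_eq (IsIso.hom_inv_id F), hom_comp_eq (IsIso.inv_hom_id F)⟩

/-- A homomorphism with invertible cell is invertible. -/
theorem MonHom.isIso_of_isIsoCell {M N : Mod C} (F : M ⟶ N) (h : IsIsoCell (MonHom.cell F)) :
    IsIso F := by
  have hc := h.isCartesian
  obtain ⟨f', g', ψ, hf, hg, hf', hg', h₁, h₂⟩ := h
  -- A homomorphism has the same frame on both sides. The two frames of the inverse cell are
  -- inverses of the same arrow, so they coincide.
  obtain rfl : f' = g' := by
    rw [← Category.id_comp g', ← hf', Category.assoc, hg, Category.comp_id]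
  let G : N ⟶ M :=
    { hom := f'
      cell := ψ
      map_one := by
        -- Both laws for the inverse are tested after composing with the invertible, hence
        -- cartesian, cell of `F`, where they reduce to the laws for `F`.
        apply hc.hom_ext hf' hf'
        refine (comp_one_comp _ _ _ _ _ hf' hf' (Category.id_comp _) (Category.id_comp _)
          _ _).trans ?_
        rw [h₂, comp_idc]
        refine .symm ((comp_one_comp (.nil f') M.mon.one _ _ _ (Category.id_comp _)
          (Category.id_comp _) hf' hf' _ _).trans ?_)
        rw [MonHom.map_one F]
        refine (assoc _ (.nil hf') _ _ _ _ (Category.id_comp _) (Category.id_comp _)).trans ?_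
        exact ids_comp N.mon.one
      map_mul := by
        apply hc.hom_ext hf' hf'
        refine (comp_one_comp _ _ _ _ _ hf' hf' (Category.id_comp _) (Category.id_comp _)
          _ _).trans ?_
        rw [h₂, comp_idc]
        refine .symm ((comp_one_comp (P := .cons N.pro (.one N.pro)) (.two ψ ψ rfl) M.mon.mul
          _ _ _ (Category.id_comp _) (Category.id_comp _) hf' hf' _ _).trans ?_)
        rw [MonHom.map_mul F]
        refine (comp_comp_two _ (isAppend_one _ _ _) hf' hf' hf' h₂ h₂ _ rfl _ _ _ _
          (Category.id_comp _) (Category.id_comp _)).trans ?_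
        exact ids_comp N.mon.mul }
  exact ⟨G, MonHom.ext_comp hf
      ((comp_one_comp _ _ _ rfl rfl (Category.comp_id _) (Category.comp_id _) hf hf
          _ _).trans ((congrArg (fun t => VirtualDoubleStruct.comp _ t _ _)
            (comp_idc ψ)).trans h₁)),
    MonHom.ext_comp hf'
      ((comp_one_comp _ _ _ rfl rfl (Category.comp_id _) (Category.comp_id _) hf' hf'
          _ _).trans ((congrArg (fun t => VirtualDoubleStruct.comp _ t _ _)
            (comp_idc (MonHom.cell F))).trans h₂))⟩

end Iso

/-! ### Normal collapses, regular covers and bimodule collapses -/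

section Regular

variable {C : Type u} [Category.{v} C] [VirtualDoubleCategory.{w, z} C] {U : Units (Mod C)}

/-- The two cells differ by the invertible comparison between the chosen and the canonical unit of
`Y`. -/
theorem isIsoCell_embHom_iff {X Y : Mod C} {M : MonoidOn X} (i : Emb U M Y) :
    IsIsoCell (MonHom.cell (embHom i)) ↔
      IsIsoCell (P := M.total.pro) (BimodHom.cell i.cell) := by
  constructor
  · intro h
    have := h.comp (IsIsoCell.under (Y.unitOf.isIsoCell_map (U.unit Y))) (Category.comp_id _)
      (Category.comp_id _)
    have e : comp (C := Mod C) (.one (C := Mod C) (i.changeUnit Y.unitOf).cell)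
        (Y.unitOf.map (U.unit Y) (𝟙 Y)) (Category.comp_id _) (Category.comp_id _) = i.cell := by
      refine (comp_one_comp _ _ _ _ _ (Category.id_comp _) (Category.id_comp _)
        (Category.comp_id _) (Category.comp_id _) _ _).trans ?_
      rw [(U.unit Y).map_comp _ _ _ _ (Category.id_comp _), UnitOf.map_id, comp_idc]
    exact congrArg BimodHom.cell e ▸ this
  · intro h
    exact h.comp (IsIsoCell.under ((U.unit Y).isIsoCell_map Y.unitOf)) (Category.comp_id _)
      (Category.comp_id _)

section

variable {X X' Y Y' : Mod C} {M : MonoidOn X} {N : MonoidOn X'} {i : Emb U M Y} {j : Emb U N Y'}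
  {B : Bimod (⟨X, M⟩ : Mod (Mod C)) ⟨X', N⟩} {P : Bimod Y Y'}

/-- The composite is formed among homomorphisms out of the total bimodule and read back as an
embedding, so that the uniqueness clause of a bimodule collapse applies to it. -/
theorem exists_bimodEmb_comp (φ : BimodEmb U i j B P) {Z Z' : Mod C} {h : Y ⟶ Z} {k : Y' ⟶ Z'}
    {Q : Bimod Z Z'} (χ : BimodHom h k (.one P) Q) :
    ∃ ψ : BimodEmb U (i.comp (U.trivialHom h)) (j.comp (U.trivialHom k)) B Q,
      comp (C := Mod C) (.one φ.cell) χ rfl rfl = ψ.cell := by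
  obtain ⟨ψ, hψ⟩ := exists_bimodEmb (i := i.comp (U.trivialHom h))
    (j := j.comp (U.trivialHom k)) (B := B) (Q := Q)
    (BimodHom.comp (.one (C := Mod C) (bimodEmbHom φ)) χ (embHom_comp i h).symm
      (embHom_comp j k).symm)
  exact ⟨ψ, BimodHom.ext hψ.symm⟩

theorem isBimodCollapse_of_isIsoCell [IsIso (embHom i)] [IsIso (embHom j)]
    (φ : BimodEmb U i j B P) (hφ : IsIsoCell (P := B.total.pro) (embCell φ).cell) :
    IsBimodCollapse φ := by
  -- Invertibility is lifted from `C` to `Mod C` through cartesianness: the cell is cartesian in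
  -- `Mod C`, over frames that are invertible there. Precomposition with it is then the required
  -- bijection.
  have hΦ := ((bimodEmbHom φ).isCartesian_of_cell hφ.isCartesian).isIsoCell
  refine ⟨.of_isIso i, .of_isIso j, fun Z Z' h k Q ψ => ?_⟩
  obtain ⟨χ, hχ, huniq⟩ := hΦ.existsUnique_precomp (embHom_comp i h).symm (embHom_comp j k).symm
    (bimodEmbHom ψ)
  have hχ' := congrArg BimodHom.cell hχ
  refine ⟨χ, BimodHom.ext hχ', fun χ' h' => huniq χ' (BimodHom.ext ?_)⟩
  have h'' := congrArg BimodHom.cell h'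
  exact h''

theorem IsBimodCollapse.isIsoCell {φ : BimodEmb U i j B P} (hφ : IsBimodCollapse φ) :
    IsIsoCell (P := B.total.pro) (embCell φ).cell := by
  obtain ⟨hi, hj, huniv⟩ := hφ
  have := hi.isIso
  have := hj.isIso
  -- The identity of the total bimodule, read as an embedding of `B`. Its frames are `embHom i` and
  -- `embHom j` followed by their inverses, so it has the form to which the universal property of
  -- `φ` applies, and its factorisation `χ` is the candidate inverse.
  obtain ⟨ψ, hψ⟩ := exists_bimodEmb (i := i.comp (U.trivialHom (inv (embHom i))))
    (j := j.comp (U.trivialHom (inv (embHom j)))) (B := B) (Q := B.total)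
    (BimodHom.comp (.one (C := Mod C) (BimodHom.id B.total)) (BimodHom.id B.total)
      (by rw [embHom_comp, IsIso.hom_inv_id, Category.comp_id])
      (by rw [embHom_comp, IsIso.hom_inv_id, Category.comp_id]))
  obtain ⟨χ, hχ, -⟩ := huniv _ _ _ ψ
  have h₁ : comp (.one (bimodEmbHom φ).cell) (BimodHom.cell χ)
      (hom_comp_eq (IsIso.hom_inv_id (embHom i))) (hom_comp_eq (IsIso.hom_inv_id (embHom j))) =
      idc B.total.pro := by
    refine .trans ?_ (comp_idc (idc B.total.pro))
    exact comp_eq_comp_congr ((congrArg BimodHom.cell hχ).trans hψ) _ _ _ _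
  -- The other composite is an endomorphism of `P`. By `h₁`, it and the identity have the same
  -- composite with `φ`, so uniqueness of factorisations identifies them.
  have h₂ : comp (C := Mod C) (.one (C := Mod C) χ) (bimodEmbHom φ) (IsIso.inv_hom_id (embHom i))
      (IsIso.inv_hom_id (embHom j)) = idc (C := Mod C) P := by
    obtain ⟨ψ', hψ'⟩ := exists_bimodEmb_comp φ (BimodHom.id P)
    refine (huniv (𝟙 Y) (𝟙 Y') P ψ').unique (.trans ?_ hψ') hψ'
    refine BimodHom.ext ?_
    refine (comp_one_comp _ _ _ (hom_comp_eq (IsIso.hom_inv_id (embHom i)))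
      (hom_comp_eq (IsIso.hom_inv_id (embHom j))) _ _ _ _
      ((Category.id_comp _).trans (Category.comp_id _).symm)
      ((Category.id_comp _).trans (Category.comp_id _).symm)).symm.trans ?_
    refine (congrArg (fun t => comp (.one t) _ _ _) h₁).trans ?_
    exact (comp_idc_eq_idc_comp (embCell φ).cell _ _ _ _).symm
  exact ⟨_, _, BimodHom.cell χ, _, _, hom_comp_eq (IsIso.inv_hom_id (embHom i)),
    hom_comp_eq (IsIso.inv_hom_id (embHom j)), h₁, congrArg BimodHom.cell h₂⟩

end

/-- Normality is automatic: the embedding of the unit bimodule has the same cell as `i`, and that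
cell is invertible along with `embHom i`. -/
theorem isNormalCollapse_of_isIso {X Y : Mod C} {M : MonoidOn X} (i : Emb U M Y)
    [IsIso (embHom i)] : IsNormalCollapse i :=
  ⟨.of_isIso i, isBimodCollapse_of_isIsoCell _
    ((isIsoCell_embHom_iff i).1 (MonHom.isIsoCell_cell (embHom i)))⟩

variable (U) in
theorem hasNormalCollapse_mod {X : Mod C} (M : MonoidOn X) : HasNormalCollapse U M := by
  obtain ⟨i, hi⟩ := exists_embHom_eq_id U M
  have : IsIso (embHom i) := by rw [hi]; infer_instance
  exact ⟨_, i, isNormalCollapse_of_isIso i⟩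

/-- Over an invertible underlying arrow, the cartesian cell of the kernel is invertible in `C`, and
a homomorphism with an invertible cell is invertible. -/
theorem IsKernel.isIso_embHom (hC : IsVirtualEquipment C) {X Y : Mod C} {F : X ⟶ Y}
    (hF : IsIso (MonHom.hom F)) {M : MonoidOn X} {i : Emb U M Y} (hi : IsKernel F i) :
    IsIso (embHom i) := by
  obtain ⟨rfl, hi⟩ := hi
  exact MonHom.isIso_of_isIsoCell _ ((isIsoCell_embHom_iff i).2
    ((BimodHom.isCartesian_iff_isIsoCell hC hF hF i.cell).1 hi))

theorem isRegularCover_iff (hC : IsVirtualEquipment C) {X Y : Mod C} (F : X ⟶ Y) :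
    IsRegularCover U F ↔ IsIso (MonHom.hom F) := by
  constructor
  -- A collapse makes `embHom i` invertible, and `embHom i` has the same underlying arrow in `C` as
  -- the cover.
  · rintro ⟨M, i, ⟨rfl, -⟩, hi, -⟩
    have := hi.isIso
    exact MonHom.isIso_hom (embHom i)
  · intro hF
    -- The kernel of `F` is constructed as the restriction of the chosen unit of `Y` with its
    -- inherited monoid structure. Its embedding is then a normal collapse.
    obtain ⟨P, κ, hκ⟩ := (isVirtualEquipment_mod hC).has_restrictions F F (U.unit Y).pro
    obtain ⟨M, i, hi⟩ := MonoidOn.exists_restrict (U.unit Y).trivialOn hκ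
    have := IsKernel.isIso_embHom hC hF (i := i) hi
    exact ⟨M, i, hi, isNormalCollapse_of_isIso i⟩

/-- Both properties are equivalent to invertibility of the underlying cell in `C`. -/
theorem isBimodCollapse_iff_isCartesian (hC : IsVirtualEquipment C) {X X' Y Y' : Mod C}
    {F : X ⟶ Y} {G : X' ⟶ Y'} (hF : IsRegularCover U F) (hG : IsRegularCover U G)
    {M : MonoidOn X} {N : MonoidOn X'} {i : Emb U M Y} {j : Emb U N Y'} (hi : IsKernel F i)
    (hj : IsKernel G j) {A : Bimod (⟨X, M⟩ : Mod (Mod C)) ⟨X', N⟩} {B : Bimod Y Y'}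
    (φ : BimodEmb U i j A B) : IsBimodCollapse φ ↔ IsCartesian φ.cell := by
  rw [isRegularCover_iff hC] at hF hG
  have := hi.isIso_embHom hC hF
  have := hj.isIso_embHom hC hG
  obtain ⟨rfl, -⟩ := hi
  obtain ⟨rfl, -⟩ := hj
  exact ⟨fun h => (BimodHom.isCartesian_iff_isIsoCell hC hF hG (embCell φ)).2 h.isIsoCell,
    fun h => isBimodCollapse_of_isIsoCell φ
      ((BimodHom.isCartesian_iff_isIsoCell hC hF hG (embCell φ)).1 h)⟩

end Regular

end VDC

theorem mainTheorem4 {C : Type u} [Category.{v} C] [VDC.VirtualDoubleCategory.{w, z} C]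
    (hC : VDC.IsVirtualEquipment C) :
    VDC.IsRegularVirtualEquipment (VDC.Mod C) ∧
    ∀ U : VDC.Units (VDC.Mod C),
      (∀ (X : VDC.Mod C) (M : VDC.MonoidOn X), VDC.HasNormalCollapse U M) ∧
      (∀ (X Y : VDC.Mod C) (F : X ⟶ Y),
        VDC.IsRegularCover U F ↔ IsIso (VDC.MonHom.hom F)) ∧
      (∀ (X X' Y Y' : VDC.Mod C) (F : X ⟶ Y) (G : X' ⟶ Y'),
        VDC.IsRegularCover U F → VDC.IsRegularCover U G →
        (∀ (A : VDC.Bimod X X') (B : VDC.Bimod Y Y') (φ : VDC.BimodHom F G (.one A) B),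
          VDC.IsCartesian (C := VDC.Mod C) φ ↔ VDC.IsIsoCell φ.cell) ∧
        (∀ (M : VDC.MonoidOn X) (N : VDC.MonoidOn X') (i : VDC.Emb U M Y) (j : VDC.Emb U N Y'),
          VDC.IsKernel F i → VDC.IsKernel G j →
          ∀ (A : VDC.Bimod (⟨X, M⟩ : VDC.Mod (VDC.Mod C)) ⟨X', N⟩) (B : VDC.Bimod Y Y')
            (φ : VDC.BimodEmb U i j A B),
            VDC.IsBimodCollapse φ ↔ VDC.IsCartesian φ.cell)) := by
  refine ⟨⟨VDC.isVirtualEquipment_mod hC, fun U _ M _ => VDC.hasNormalCollapse_mod U M,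
    fun U _ _ _ _ F G hF hG _ _ _ _ hi hj _ _ φ =>
      (VDC.isBimodCollapse_iff_isCartesian hC hF hG hi hj φ).2⟩, fun U => ⟨fun X M =>
    VDC.hasNormalCollapse_mod U M, fun X Y F => VDC.isRegularCover_iff hC F,
    fun X X' Y Y' F G hF hG => ⟨fun A B φ => ?_, fun M N i j hi hj A B φ =>
      VDC.isBimodCollapse_iff_isCartesian hC hF hG hi hj φ⟩⟩⟩
  exact VDC.BimodHom.isCartesian_iff_isIsoCell hC ((VDC.isRegularCover_iff hC F).1 hF)
    ((VDC.isRegularCover_iff hC G).1 hG) φ
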